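/- **Setting.** Let $\mathcal X$ be a set of contexts, $K$ a number of coordinates, and let actions be vectors $a\in\{0,1\}^K$ (write $j\in a$ for $a(j)=1$). Let $\Pi$ be a finite class of $N$ policies $\pi:\mathcal X\to\{0,1\}^K$ such that every $\pi(x)$ has at most $m$ ones ($m=1$ for contextual bandits). In each round $t=1,\dots,T$ an adaptive (possibly randomized) adversary chooses a context $x^t\in\mathcal X$ and a non-negative loss vector $\ell^t\in\mathbb R_{\ge 0}^K$, knowing all that happened before round $t$ (including all the past randomness of the learner) but not the randomness that the learner uses in round $t$. The learner chooses a policy $\pi^t\in\Pi$, incurs the loss $\langle\pi^t(x^t),\ell^t\rangle$ and observes $x^t$ and only those $\ell^t(j)$ with $j\in\pi^t(x^t)$. The expected regret is $$\mathrm{Regret}=\sup_{\pi\in\Pi}\mathbb E\Big[\sum_{t=1}^T\langle\pi^t(x^t),\ell^t\rangle-\sum_{t=1}^T\langle\pi(x^t),\ell^t\rangle\Big].$$ The learner accesses $\Pi$ only through an oracle $M$ that maps any finite sequence of pairs $(x,\ell)\in\mathcal X\times\mathbb R^K$ to a policy of $\Pi$ of minimal cumulative linear loss on it, with consistent deterministic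 tie-breaking (whenever two policies are tied, it always prefers the same one). It knows a set $X\subseteq\mathcal X$ of $d$ contexts. In the *transductive* setting all $x^t$ belong to $X$; in the *small-separator* setting the $x^t$ are arbitrary and any two distinct policies of $\Pi$ differ on some $x\in X$. **Algorithm** (parameters $\varepsilon>0$ and an integer $L\ge1$). Let $D$ be the distribution of a sequence $\{z\}=(x,\ell_x)_{x\in X}$ of fake samples in which all coordinates $\ell_x(j)$ are i.i.d. Laplace with density $\frac\varepsilon2e^{-\varepsilon|s|}$. In round $t$, draw a fresh $\{z\}\sim D$ and play $\pi^t=M(\{z\}\cup(x^\tau,\hat\ell^\tau)_{\tau<t})$. Then, for each $j\in\pi^t(x^t)$, draw fresh independent $\{z\}^{1},\dots,\{z\}^{L}\sim D$, let $J^t(j)$ be the least $i\le L$ with $j\in M(\{z\}^{i}\cup(x^\tau,\hat\ell^\tau)_{\tau<t})(x^t)$, and $J^t(j)=L$ if there is none, and put $\hat\ell^t(j)=J^t(j)\,\ell^t(j)$; put $\hat\ell^t(j)=0$ for $j\notin\pi^t(x^t)$. For $\ell\in\mathbb R^K$ let $\|\ell\|$ be the maximum of $|\ell(j)|$ over all $j$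 that belong to $\pi(x)$ for some $\pi\in\Pi$, $x\in\mathcal X$ (and $0$ if there is no such $j$). Assume that $\mathbb E\|\ell^t\|^2<\infty$ for all $t$. **Theorem.** (i) For all $\varepsilon>0$ and $L\ge1$, in the transductive setting $$\mathrm{Regret}\le 2\varepsilon mK\sum_{t=1}^T\mathbb E\|\ell^t\|^2+\frac{10}{\varepsilon}\sqrt{dm}\,\log N+\frac{K}{eL}\sum_{t=1}^T\mathbb E\|\ell^t\|,$$ and in the small-separator setting $$\mathrm{Regret}\le 8\varepsilon K^2dLm\sum_{t=1}^T\mathbb E\|\ell^t\|^2+\frac{10}{\varepsilon}\sqrt{dm}\,\log N+\frac{K}{eL}\sum_{t=1}^T\mathbb E\|\ell^t\|.$$ (ii) There is a universal constant $c>0$ such that for all $K,m,d,N,T$ the following holds whenever $\|\ell^t\|\le1$ for all $t$ (for instance if $\ell^t\in[0,1]^K$). For some $\varepsilon>0$ and $L\ge1$ that depend only on $K,m,d,N,T$, in the transductive setting $$\mathrm{Regret}\le c\,d^{1/4}m^{3/4}\sqrt{KT\log N},$$ and hence $\mathrm{Regret}\le c\,m^{3/4}\,T^{3/4}\sqrt{K\log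 N}$ if $d\le T$. For some (possibly other) $\varepsilon>0$ and $L\ge1$ that depend only on $K,m,d,N,T$, in the small-separator setting $$\mathrm{Regret}\le c\,T^{2/3}d^{3/4}m^{3/4}K\sqrt{\log N}.$$ For $m=1$ the last two bounds are $O(T^{3/4}\sqrt{K\log N})$ and $O(T^{2/3}d^{3/4}K\sqrt{\log N})$. -/

import Mathlib

open MeasureTheory ProbabilityTheory

universe u v

namespace SemiBandit

/-- Actions are vectors of `{0,1}^K`, represented by their supports; a policy maps contexts to
actions. -/
abbrev Policy (C : Type*) (K : ℕ) : Type _ := C → Finset (Fin K)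

/-- An outcome is a context together with a loss vector. -/
abbrev Outcome (C : Type*) (K : ℕ) : Type _ := C × (Fin K → ℝ)

/-- The linear loss `⟨a, l⟩` of an action. -/
def actionLoss {K : ℕ} (a : Finset (Fin K)) (l : Fin K → ℝ) : ℝ := ∑ j ∈ a, l j

/-- The cumulative loss of a policy on a sequence of outcomes. -/
def cumLoss {C : Type*} {K : ℕ} (p : Policy C K) (y : List (Outcome C K)) : ℝ :=
  (y.map fun o => actionLoss (p o.1) o.2).sum

/-- `M` is an offline optimization oracle for the policy class `P`: on every sequence of outcomes
it returns a policy of `P` of minimal cumulative loss, and it breaks ties consistently: if the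
policies returned on two sequences are both optimal on both sequences, then they are equal. -/
structure IsOracle {C : Type*} {K : ℕ} (P : Finset (Policy C K))
    (M : List (Outcome C K) → Policy C K) : Prop where
  mem : ∀ y, M y ∈ P
  isMin : ∀ y, ∀ p ∈ P, cumLoss (M y) y ≤ cumLoss p y
  consistent : ∀ y y', cumLoss (M y') y = cumLoss (M y) y →
    cumLoss (M y) y' = cumLoss (M y') y' → M y = M y'

/-- `X` is a separator of `P`: any two distinct policies differ on some context of `X`. -/
def IsSeparator {C : Type*} {K : ℕ} (P : Finset (Policy C K)) (X : Finset C) : Prop :=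
  ∀ p ∈ P, ∀ q ∈ P, p ≠ q → ∃ x ∈ X, p x ≠ q x

/-- The largest absolute value of a loss coordinate that some policy can select (`0` if no
coordinate can be selected). It is at most `max_j |l j|` and, for non-negative `l`, at most
the largest loss `⟨a, l⟩` of an action taken by some policy. -/
noncomputable def selNorm {C : Type*} {K : ℕ} (P : Finset (Policy C K)) (l : Fin K → ℝ) : ℝ :=
  ⨆ j : {j : Fin K // ∃ p ∈ P, ∃ x, j ∈ p x}, |l j|

/-! ### The noise -/

/-- The Laplace distribution with parameter `ε`, of density `(ε / 2) exp (-ε |z|)`. -/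
noncomputable def laplace (ε : ℝ) : Measure ℝ :=
  volume.withDensity fun z => ENNReal.ofReal (ε / 2 * Real.exp (-(ε * |z|)))

/-- One fake loss vector for each context of `X`. -/
abbrev FakeLosses {C : Type*} (X : Finset C) (K : ℕ) : Type _ := {x : C // x ∈ X} × Fin K → ℝ

/-- The fake loss vectors have i.i.d. Laplace coordinates. -/
noncomputable def fakeLaw {C : Type*} (X : Finset C) (K : ℕ) (ε : ℝ) :
    Measure (FakeLosses X K) :=
  Measure.pi fun _ => laplace ε

/-- The randomness of the learner in one round: the fake losses used to select the policy and,
for each coordinate `j` and each `i < L`, the fake losses of the `i`-th resampling step. -/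
abbrev RoundNoise {C : Type*} (X : Finset C) (K L : ℕ) : Type _ :=
  FakeLosses X K × (Fin K × Fin L → FakeLosses X K)

/-- All fake loss vectors of a round are independent and identically distributed. -/
noncomputable def roundLaw {C : Type*} (X : Finset C) (K L : ℕ) (ε : ℝ) :
    Measure (RoundNoise X K L) :=
  (fakeLaw X K ε).prod (Measure.pi fun _ => fakeLaw X K ε)

/-! ### The learner, which uses the policy class only through the oracle `M` -/

/-- The sequence of fake samples `(x, z_x)`, `x ∈ X`. -/
noncomputable def fakeSamples {C : Type*} {K : ℕ} (X : Finset C) (z : FakeLosses X K) :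
    List (Outcome C K) :=
  X.attach.toList.map fun x => (x.1, fun j => z (x, j))

/-- The policy that the oracle returns on the fake samples followed by a sequence `h`. -/
noncomputable def ftplPolicy {C : Type*} {K : ℕ} (M : List (Outcome C K) → Policy C K)
    (X : Finset C) (h : List (Outcome C K)) (z : FakeLosses X K) : Policy C K :=
  M (fakeSamples X z ++ h)

/-- Truncated geometric resampling for the coordinate `j`: the first of the `L` fresh
perturbed leaders (counted from `1`) whose action in context `x` contains `j`, and `L` if there
is none. -/
noncomputable def resampleCount {C : Type*} {K L : ℕ} (M : List (Outcome C K) → Policy C K)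
    (X : Finset C) (h : List (Outcome C K)) (w : Fin K × Fin L → FakeLosses X K)
    (x : C) (j : Fin K) : ℕ :=
  sInf ({n : ℕ | ∃ i : Fin L, n = (i : ℕ) + 1 ∧ j ∈ ftplPolicy M X h (w (j, i)) x} ∪ {L})

/-- The loss estimate computed from the semi-bandit feedback `fb`, that is, from the losses of
the coordinates of the action `a` that was played. -/
noncomputable def lossEstimate {C : Type*} {K L : ℕ} (M : List (Outcome C K) → Policy C K)
    (X : Finset C) (h : List (Outcome C K)) (w : Fin K × Fin L → FakeLosses X K)
    (x : C) (a : Finset (Fin K)) (fb : {j : Fin K // j ∈ a} → ℝ) : Fin K → ℝ :=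
  fun j => if hj : j ∈ a then (resampleCount M X h w x j : ℝ) * fb ⟨j, hj⟩ else 0

/-- The contexts and estimated losses of the rounds before `t`, when the contexts, the
losses and the noise of the rounds are `x`, `l` and `ξ`. In round `t` the learner plays the
perturbed leader for the estimated history. -/
noncomputable def estHistory {C : Type*} {K L : ℕ} (M : List (Outcome C K) → Policy C K)
    (X : Finset C) (x : ℕ → C) (l : ℕ → Fin K → ℝ) (ξ : ℕ → RoundNoise X K L) :
    ℕ → List (Outcome C K)
  | 0 => []
  | t + 1 =>
    estHistory M X x l ξ t ++
      [(x t, lossEstimate M X (estHistory M X x l ξ t) (ξ t).2 (x t)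
        (ftplPolicy M X (estHistory M X x l ξ t) (ξ t).1 (x t)) fun j => l t j.1)]

/-! ### Interaction with an adaptive adversary -/

set_option linter.checkUnivs false in
/-- A run of `T` rounds (numbered `0, …, T - 1`) of the learner with parameters `ε`, `L` against
an adaptive adversary: `K` coordinates, `N` policies, actions with at most `m` coordinates, and
a set `X` of `d` contexts known to the learner.

`ℱ t` is what the adversary may know when it selects the context and the loss vector of round
`t`: it contains all the randomness that the learner has used before round `t` (hence the
whole history of play) and possibly randomness of the adversary, and it is independent of the
randomness that the learner uses in round `t`. -/
structure Run (K m d N T L : ℕ) (ε : ℝ) where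
  C : Type u
  [mC : MeasurableSpace C]
  policies : Finset (Policy C K)
  card_policies : policies.card = N
  policies_measurable : ∀ p ∈ policies, ∀ j, MeasurableSet {x | j ∈ p x}
  card_action_le : ∀ p ∈ policies, ∀ x, (p x).card ≤ m
  X : Finset C
  card_X : X.card = d
  M : List (Outcome C K) → Policy C K
  isOracle : IsOracle policies M
  Ω : Type v
  [mΩ : MeasurableSpace Ω]
  μ : Measure Ω
  [prob : IsProbabilityMeasure μ]
  ℱ : Filtration ℕ mΩ
  context : ℕ → Ω → C
  loss : ℕ → Ω → Fin K → ℝ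
  noise : ℕ → Ω → RoundNoise X K L
  context_measurable : ∀ t < T, Measurable[ℱ t] (context t)
  loss_measurable : ∀ t < T, Measurable[ℱ t] (loss t)
  loss_nonneg : ∀ t < T, ∀ ω j, 0 ≤ loss t ω j
  loss_sq_integrable : ∀ t < T, Integrable (fun ω => selNorm policies (loss t ω) ^ 2) μ
  noise_measurable : ∀ t < T, Measurable[ℱ (t + 1)] (noise t)
  noise_law : ∀ t < T, μ.map (noise t) = roundLaw X K L ε
  noise_indep : ∀ t < T, Indep (MeasurableSpace.comap (noise t) inferInstance) (ℱ t) μ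

attribute [instance] Run.mC Run.mΩ Run.prob

namespace Run

/-- The policy played in round `t`. -/
noncomputable def played {K m d N T L : ℕ} {ε : ℝ} (R : Run.{u, v} K m d N T L ε)
    (t : ℕ) (ω : R.Ω) : Policy R.C K :=
  ftplPolicy R.M R.X
    (estHistory R.M R.X (fun s => R.context s ω) (fun s => R.loss s ω) (fun s => R.noise s ω) t)
    (R.noise t ω).1

/-- The expected regret against the best policy. -/
noncomputable def regret {K m d N T L : ℕ} {ε : ℝ} (R : Run.{u, v} K m d N T L ε) : ℝ :=
  ⨆ p : {p : Policy R.C K // p ∈ R.policies},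
    ∫ ω, (∑ t ∈ Finset.range T, actionLoss (R.played t ω (R.context t ω)) (R.loss t ω)
      - ∑ t ∈ Finset.range T, actionLoss (p.1 (R.context t ω)) (R.loss t ω)) ∂(R.μ)

/-- The transductive setting: all the contexts that arrive belong to `X`. -/
def Transductive {K m d N T L : ℕ} {ε : ℝ} (R : Run.{u, v} K m d N T L ε) : Prop :=
  ∀ t < T, ∀ ω, R.context t ω ∈ R.X

/-- The small separator setting: `X` is a separator of the policy class (and the contexts that
arrive are arbitrary). -/
def SmallSeparator {K m d N T L : ℕ} {ε : ℝ} (R : Run.{u, v} K m d N T L ε) : Prop :=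
  IsSeparator R.policies R.X

/-- The coordinates of the loss vectors that some policy can select are at most `1`. -/
def LossLeOne {K m d N T L : ℕ} {ε : ℝ} (R : Run.{u, v} K m d N T L ε) : Prop :=
  ∀ t < T, ∀ ω, selNorm R.policies (R.loss t ω) ≤ 1

/-- `∑ t, E ‖ℓ t‖`. -/
noncomputable def sumLoss {K m d N T L : ℕ} {ε : ℝ} (R : Run.{u, v} K m d N T L ε) : ℝ :=
  ∑ t ∈ Finset.range T, ∫ ω, selNorm R.policies (R.loss t ω) ∂(R.μ)

/-- `∑ t, E ‖ℓ t‖²`. -/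
noncomputable def sumSqLoss {K m d N T L : ℕ} {ε : ℝ} (R : Run.{u, v} K m d N T L ε) : ℝ :=
  ∑ t ∈ Finset.range T, ∫ ω, selNorm R.policies (R.loss t ω) ^ 2 ∂(R.μ)

end Run

end SemiBandit

namespace SemiBandit

/-! ### The Laplace distribution -/

/-! Condition on the past of a round and let q_j (`selProb`) be the probability that the perturbed
leader of the estimated history plays j. The learner's expected loss is Σ_j q_j ℓ_j. The resampling
count J(j) is truncated geometric and independent of the action played, with q_j E J(j) = 1 - (1 -
q_j)^L, so the estimate has mean (1 - (1 - q_j)^L) ℓ_j. This underestimates: it can only lower the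
comparator's estimated loss, and on the learner's side it costs Σ_j q_j (1 - q_j)^L ℓ_j ≤ K ‖ℓ‖ /
(eL) (`IsOracle.integral_bias_le`).

What remains is the regret for the estimated losses, with the learner charged Σ_j q_j ℓ̂_j. It is
bounded path by path: once a path is fixed, the estimates form a fixed sequence, and the charge
depends only on the law of the leader in each round. Hence one noise vector z, integrated
separately, may serve all rounds, and be-the-leader bounds the regret by the cost of the noise plus
the stability terms (`IsOracle.ftpl_regret_le`). The noise cost is an expected maximum over N
policies of sums of at most dm Laplace variables, controlled by exponential moments
(`IsOracle.integral_noise_le`).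

Stability rests on one fact: shifting Laplace noise by a changes the mass of events by a factor of
at most exp(ε ‖a‖₁). In the transductive setting a new outcome is itself a shift of the noise, which
gives ε (Σ ℓ̂_i)(Σ q_j ℓ̂_j) (`IsOracle.stability_transductive`). With a separator the context may
lie outside X, but a change of leader must be visible at some pair (y, j) with y in X; each such
pair has probability at most 2 ε Σ ℓ̂_i, which gives 2 ε d K (Σ ℓ̂_i)²
(`IsOracle.stability_separator`).

The conditional second moments are then at most 2mK ‖ℓ‖², because the factor q_j compensates the
variance of the estimate (`IsOracle.integral_sum_mul_sum_le`), and mKL ‖ℓ‖², where only the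
truncation at L helps (`IsOracle.integral_sq_sum_le`). Independence of the noise from the past turns
these into bounds against an adaptive adversary (`Run.regret_le`), and the tuned bounds follow by
balancing ε and L. -/

lemma laplace_pdf_shift_le {ε : ℝ} (hε : 0 < ε) (z a : ℝ) :
    Real.exp (-(ε * |z|)) ≤ Real.exp (ε * |a|) * Real.exp (-(ε * |z - a|)) := by
  rw [← Real.exp_add, Real.exp_le_exp]
  have : |z - a| ≤ |z| + |a| := abs_sub z a
  nlinarith

lemma measurable_laplace_pdf (ε : ℝ) :
    Measurable fun z : ℝ => ENNReal.ofReal (ε / 2 * Real.exp (-(ε * |z|))) := by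
  fun_prop

lemma lintegral_laplace_shift_le {ε : ℝ} (hε : 0 < ε) (a : ℝ) {f : ℝ → ENNReal}
    (hf : Measurable f) :
    ∫⁻ z, f z ∂(laplace ε)
      ≤ ENNReal.ofReal (Real.exp (ε * |a|)) * ∫⁻ z, f (z + a) ∂(laplace ε) := by
  unfold laplace
  rw [lintegral_withDensity_eq_lintegral_mul _ (measurable_laplace_pdf ε) hf,
    lintegral_withDensity_eq_lintegral_mul _ (measurable_laplace_pdf ε) (by fun_prop),
    ← lintegral_const_mul _ (by fun_prop),
    ← lintegral_sub_right_eq_self (fun z => ENNReal.ofReal (Real.exp (ε * |a|)) * _) a]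
  refine lintegral_mono fun z => ?_
  simp only [Pi.mul_apply, sub_add_cancel]
  rw [← mul_assoc, ← ENNReal.ofReal_mul (Real.exp_nonneg _)]
  refine mul_le_mul_left (ENNReal.ofReal_le_ofReal ?_) _
  have := laplace_pdf_shift_le hε z a
  nlinarith

lemma integrableOn_laplace_exp_mul_Iic {ε t : ℝ} (ht : |t| < ε) :
    IntegrableOn (fun z : ℝ => ε / 2 * Real.exp (-(ε * |z|)) * Real.exp (t * z)) (Set.Iic 0) ∧
    ∫ z in Set.Iic (0 : ℝ), ε / 2 * Real.exp (-(ε * |z|)) * Real.exp (t * z)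
      = ε / 2 * (1 / (ε + t)) := by
  have h0 : 0 < ε + t := by linarith [neg_abs_le t]
  have heq : Set.EqOn (fun z : ℝ => ε / 2 * Real.exp (-(ε * |z|)) * Real.exp (t * z))
      (fun z => ε / 2 * Real.exp ((ε + t) * z)) (Set.Iic 0) := by
    intro z hz
    simp only [abs_of_nonpos (Set.mem_Iic.1 hz)]
    rw [mul_assoc, ← Real.exp_add]
    ring_nf
  constructor
  · exact IntegrableOn.congr_fun (Integrable.const_mul (integrableOn_exp_mul_Iic h0 0) _) heq.symm
      measurableSet_Iic
  · rw [setIntegral_congr_fun measurableSet_Iic heq, integral_const_mul,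
      integral_exp_mul_Iic h0]
    simp

lemma integrableOn_laplace_exp_mul_Ioi {ε t : ℝ} (ht : |t| < ε) :
    IntegrableOn (fun z : ℝ => ε / 2 * Real.exp (-(ε * |z|)) * Real.exp (t * z)) (Set.Ioi 0) ∧
    ∫ z in Set.Ioi (0 : ℝ), ε / 2 * Real.exp (-(ε * |z|)) * Real.exp (t * z)
      = ε / 2 * (1 / (ε - t)) := by
  have h0 : t - ε < 0 := by linarith [le_abs_self t]
  have heq : Set.EqOn (fun z : ℝ => ε / 2 * Real.exp (-(ε * |z|)) * Real.exp (t * z))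
      (fun z => ε / 2 * Real.exp ((t - ε) * z)) (Set.Ioi 0) := by
    intro z hz
    simp only [abs_of_pos (Set.mem_Ioi.1 hz)]
    rw [mul_assoc, ← Real.exp_add]
    ring_nf
  constructor
  · exact IntegrableOn.congr_fun (Integrable.const_mul (integrableOn_exp_mul_Ioi h0 0) _) heq.symm
      measurableSet_Ioi
  · rw [setIntegral_congr_fun measurableSet_Ioi heq, integral_const_mul,
      integral_exp_mul_Ioi h0]
    simp only [mul_zero, Real.exp_zero]
    rw [neg_div, ← div_neg, neg_sub]

lemma integrable_laplace_pdf_mul_exp {ε t : ℝ} (ht : |t| < ε) :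
    Integrable (fun z : ℝ => ε / 2 * Real.exp (-(ε * |z|)) * Real.exp (t * z)) := by
  rw [← integrableOn_univ, ← Set.Iic_union_Ioi (a := (0 : ℝ))]
  exact (integrableOn_laplace_exp_mul_Iic ht).1.union (integrableOn_laplace_exp_mul_Ioi ht).1

lemma integral_laplace_pdf_mul_exp {ε t : ℝ} (ht : |t| < ε) :
    ∫ z : ℝ, ε / 2 * Real.exp (-(ε * |z|)) * Real.exp (t * z) = ε ^ 2 / (ε ^ 2 - t ^ 2) := by
  have h0 : ε + t ≠ 0 := by linarith [neg_abs_le t]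
  have h1 : ε - t ≠ 0 := by linarith [le_abs_self t]
  rw [← intervalIntegral.integral_Iic_add_Ioi (integrableOn_laplace_exp_mul_Iic ht).1
    (integrableOn_laplace_exp_mul_Ioi ht).1, (integrableOn_laplace_exp_mul_Iic ht).2,
    (integrableOn_laplace_exp_mul_Ioi ht).2, show ε ^ 2 - t ^ 2 = (ε + t) * (ε - t) by ring]
  field_simp
  ring

lemma laplace_pdf_nonneg {ε : ℝ} (hε : 0 < ε) (z : ℝ) :
    0 ≤ ε / 2 * Real.exp (-(ε * |z|)) := by positivity

lemma integral_laplace {ε : ℝ} (hε : 0 < ε) (f : ℝ → ℝ) :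
    ∫ z, f z ∂(laplace ε) = ∫ z, ε / 2 * Real.exp (-(ε * |z|)) * f z := by
  unfold laplace
  rw [integral_withDensity_eq_integral_toReal_smul (measurable_laplace_pdf ε)
    (Filter.Eventually.of_forall fun _ => ENNReal.ofReal_lt_top)]
  simp only [ENNReal.toReal_ofReal (laplace_pdf_nonneg hε _), smul_eq_mul]

lemma integrable_laplace_iff {ε : ℝ} (hε : 0 < ε) {f : ℝ → ℝ} :
    Integrable f (laplace ε) ↔ Integrable fun z => ε / 2 * Real.exp (-(ε * |z|)) * f z := by
  unfold laplace
  rw [integrable_withDensity_iff_integrable_smul' (measurable_laplace_pdf ε)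
    (Filter.Eventually.of_forall fun _ => ENNReal.ofReal_lt_top)]
  simp only [ENNReal.toReal_ofReal (laplace_pdf_nonneg hε _), smul_eq_mul]

lemma isProbabilityMeasure_laplace {ε : ℝ} (hε : 0 < ε) : IsProbabilityMeasure (laplace ε) := by
  have ht : |(0 : ℝ)| < ε := by simpa
  have h1 := integrable_laplace_pdf_mul_exp ht
  have h2 := integral_laplace_pdf_mul_exp ht
  simp only [zero_mul, Real.exp_zero, mul_one] at h1 h2
  constructor
  unfold laplace
  rw [withDensity_apply _ MeasurableSet.univ, Measure.restrict_univ,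
    ← ofReal_integral_eq_lintegral_ofReal h1
      (Filter.Eventually.of_forall (laplace_pdf_nonneg hε)), h2]
  simp [hε.ne']

lemma integrable_exp_mul_laplace {ε t : ℝ} (ht : |t| < ε) :
    Integrable (fun z => Real.exp (t * z)) (laplace ε) :=
  (integrable_laplace_iff ((abs_nonneg t).trans_lt ht)).2 (integrable_laplace_pdf_mul_exp ht)

lemma integral_exp_mul_laplace {ε t : ℝ} (ht : |t| < ε) :
    ∫ z, Real.exp (t * z) ∂(laplace ε) = ε ^ 2 / (ε ^ 2 - t ^ 2) := by
  rw [integral_laplace ((abs_nonneg t).trans_lt ht), integral_laplace_pdf_mul_exp ht]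

/-- The moment generating function at εθ is 1 / (1 - θ²), and (1 + 2s)(1 - s) ≥ 1 as long as s = θ²
≤ 1/2. -/
lemma integral_exp_mul_laplace_le {ε θ : ℝ} (hε : 0 < ε) (hθ : θ ^ 2 ≤ 1 / 4) :
    ∫ z, Real.exp (ε * θ * z) ∂(laplace ε) ≤ Real.exp (2 * θ ^ 2) := by
  have ht : |ε * θ| < ε := by
    rw [abs_mul, abs_of_pos hε]
    have : |θ| < 1 := by
      rw [← sq_lt_one_iff_abs_lt_one]; linarith
    nlinarith
  rw [integral_exp_mul_laplace ht, show ε ^ 2 - (ε * θ) ^ 2 = ε ^ 2 * (1 - θ ^ 2) by ring,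
    div_le_iff₀ (by have : 0 < 1 - θ ^ 2 := by linarith
                    positivity)]
  have h1 : 1 + 2 * θ ^ 2 ≤ Real.exp (2 * θ ^ 2) := by linarith [Real.add_one_le_exp (2 * θ ^ 2)]
  have h2 : 1 ≤ (1 + 2 * θ ^ 2) * (1 - θ ^ 2) := by nlinarith [sq_nonneg θ]
  have h3 : 1 ≤ Real.exp (2 * θ ^ 2) * (1 - θ ^ 2) :=
    h2.trans (mul_le_mul_of_nonneg_right h1 (by linarith))
  nlinarith [sq_nonneg ε]

lemma integrable_id_laplace {ε : ℝ} (hε : 0 < ε) : Integrable (fun z => z) (laplace ε) := by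
  have ht : |ε / 2| < ε := by rw [abs_of_pos (by positivity)]; linarith
  have ht' : |-(ε / 2)| < ε := by rwa [abs_neg]
  refine (((integrable_exp_mul_laplace ht).add (integrable_exp_mul_laplace ht')).const_mul
    (2 / ε)).mono' (by fun_prop) (Filter.Eventually.of_forall fun z => ?_)
  rw [Real.norm_eq_abs, ← sub_nonneg]
  have h1 := Real.add_one_le_exp (ε / 2 * z)
  have h2 := Real.add_one_le_exp (-(ε / 2) * z)
  have h3 := Real.exp_pos (ε / 2 * z)
  have h4 := Real.exp_pos (-(ε / 2) * z)
  have : |z| * (ε / 2) ≤ Real.exp (ε / 2 * z) + Real.exp (-(ε / 2) * z) := by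
    cases abs_cases z <;> nlinarith
  have h5 : |z| = 2 / ε * (|z| * (ε / 2)) := by field_simp
  rw [h5, sub_nonneg]
  simp only [Pi.add_apply]
  gcongr

lemma integral_id_laplace {ε : ℝ} (hε : 0 < ε) : ∫ z, z ∂(laplace ε) = 0 := by
  rw [integral_laplace hε]
  -- The integrand is odd, so its integral equals its own negative.
  have h := integral_neg_eq_self (fun z : ℝ => ε / 2 * Real.exp (-(ε * |z|)) * z) volume
  simp only [abs_neg, mul_neg, integral_neg] at h
  linarith

/-! ### The law of the fake losses -/

section Fake

variable {C : Type*} {X : Finset C} {K : ℕ} {ε : ℝ}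

lemma isProbabilityMeasure_fakeLaw (X : Finset C) (K : ℕ) (hε : 0 < ε) :
    IsProbabilityMeasure (fakeLaw X K ε) := by
  have := isProbabilityMeasure_laplace hε
  unfold fakeLaw
  infer_instance

lemma isProbabilityMeasure_roundLaw (X : Finset C) (K L : ℕ) (hε : 0 < ε) :
    IsProbabilityMeasure (roundLaw X K L ε) := by
  have := isProbabilityMeasure_fakeLaw X K hε
  unfold roundLaw
  infer_instance

/-- By Tonelli the coordinate i can be integrated first; the one-dimensional inequality applies to
this inner integral with the other coordinates frozen. -/
lemma lintegral_pi_shift_single_le {ι : Type*} [Fintype ι] [DecidableEq ι] (hε : 0 < ε)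
    (i : ι) (a : ℝ) {f : (ι → ℝ) → ENNReal} (hf : Measurable f) :
    ∫⁻ z, f z ∂(Measure.pi fun _ => laplace ε)
      ≤ ENNReal.ofReal (Real.exp (ε * |a|))
        * ∫⁻ z, f (z + Pi.single i a) ∂(Measure.pi fun _ => laplace ε) := by
  have := isProbabilityMeasure_laplace hε
  have hf' : Measurable fun z : ι → ℝ => f (z + Pi.single i a) := by fun_prop
  rw [lintegral_eq_lmarginal_univ (0 : ι → ℝ), lintegral_eq_lmarginal_univ (0 : ι → ℝ),
    lmarginal_erase' _ hf (Finset.mem_univ i), lmarginal_erase' _ hf' (Finset.mem_univ i)]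
  unfold lmarginal
  rw [← lintegral_const_mul]
  · refine lintegral_mono fun z => ?_
    simp only
    set y := Function.updateFinset (0 : ι → ℝ) (Finset.univ.erase i) z
    have key := lintegral_laplace_shift_le hε a (f := fun b => f (Function.update y i b))
      (hf.comp (measurable_update y))
    refine key.trans (le_of_eq ?_)
    congr 2
    funext b
    congr 1
    funext k
    by_cases hk : k = i
    · subst hk; simp
    · simp [hk]
  · have h1 : Measurable (fun y : ι → ℝ =>
        ∫⁻ b, f (Function.update y i b + Pi.single i a) ∂(laplace ε)) := by
      refine Measurable.lintegral_prod_right' (ν := laplace ε) (f := fun p : (ι → ℝ) × ℝ =>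
        f (Function.update p.1 i p.2 + Pi.single i a)) ?_
      exact hf'.comp (by fun_prop)
    exact h1.comp measurable_updateFinset

lemma lintegral_pi_shift_le {ι : Type*} [Fintype ι] (hε : 0 < ε)
    (a : ι → ℝ) {f : (ι → ℝ) → ENNReal} (hf : Measurable f) :
    ∫⁻ z, f z ∂(Measure.pi fun _ => laplace ε)
      ≤ ENNReal.ofReal (Real.exp (ε * ∑ i, |a i|))
        * ∫⁻ z, f (z + a) ∂(Measure.pi fun _ => laplace ε) := by
  -- The coordinates are shifted one at a time, and the factors multiply.
  classical
  have key : ∀ s : Finset ι, ∫⁻ z, f z ∂(Measure.pi fun _ => laplace ε)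
      ≤ ENNReal.ofReal (Real.exp (ε * ∑ i ∈ s, |a i|))
        * ∫⁻ z, f (z + ∑ i ∈ s, Pi.single i (a i)) ∂(Measure.pi fun _ => laplace ε) := by
    intro s
    induction s using Finset.induction_on with
    | empty => simp
    | insert i s his ih =>
      refine ih.trans ?_
      rw [Finset.sum_insert his, Finset.sum_insert his, mul_add, add_comm, Real.exp_add,
        ENNReal.ofReal_mul (Real.exp_nonneg _), mul_assoc]
      gcongr
      refine (lintegral_pi_shift_single_le hε i (a i) (by fun_prop)).trans (le_of_eq ?_)
      simp only [add_assoc]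
  have := key Finset.univ
  rwa [Finset.univ_sum_single] at this

/-- Shifting the noise by `a` multiplies the mass of an event by at least `exp (-ε ‖a‖₁)`. -/
lemma fakeLaw_le_smul_map (hε : 0 < ε) (a : FakeLosses X K) :
    fakeLaw X K ε ≤ ENNReal.ofReal (Real.exp (ε * ∑ i, |a i|)) •
      (fakeLaw X K ε).map (fun z => z + a) := by
  refine Measure.le_intro fun s hs _ => ?_
  have h := lintegral_pi_shift_le hε a (measurable_one.indicator hs : Measurable (s.indicator 1))
  rw [lintegral_indicator_one hs] at h
  refine h.trans (le_of_eq ?_)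
  rw [Measure.smul_apply, smul_eq_mul, Measure.map_apply (by fun_prop) hs,
    ← lintegral_indicator_one (hs.preimage (by fun_prop : Measurable fun z => z + a))]
  rfl

/-- The form in which the density ratio is used throughout: exp(-S) ≥ 1 - S makes the loss of mass
linear in ε ‖a‖₁. -/
lemma integral_le_integral_shift (hε : 0 < ε) (a : FakeLosses X K) {G : FakeLosses X K → ℝ}
    (hG : Measurable G) (h0 : ∀ z, 0 ≤ G z) {b : ℝ} (hb : ∀ z, G z ≤ b) :
    (1 - ε * ∑ i, |a i|) * ∫ z, G z ∂(fakeLaw X K ε) ≤ ∫ z, G (z + a) ∂(fakeLaw X K ε) := by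
  have := isProbabilityMeasure_fakeLaw X K hε
  have hI : Integrable G ((fakeLaw X K ε).map (fun z => z + a)) := by
    have : IsProbabilityMeasure ((fakeLaw X K ε).map (fun z => z + a)) :=
      Measure.isProbabilityMeasure_map (by fun_prop)
    exact Integrable.of_bound hG.aestronglyMeasurable b
      (Filter.Eventually.of_forall fun z => by rw [Real.norm_of_nonneg (h0 z)]; exact hb z)
  have h := integral_mono_measure (fakeLaw_le_smul_map hε a)
    (Filter.Eventually.of_forall h0) (hI.smul_measure ENNReal.ofReal_ne_top)
  rw [integral_smul_measure, ENNReal.toReal_ofReal (Real.exp_nonneg _), smul_eq_mul,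
    integral_map (by fun_prop) hG.aestronglyMeasurable] at h
  set S := ε * ∑ i, |a i|
  have hS : 1 - S ≤ Real.exp (-S) := by linarith [Real.add_one_le_exp (-S)]
  calc (1 - S) * ∫ z, G z ∂(fakeLaw X K ε)
      ≤ Real.exp (-S) * (Real.exp S * ∫ z, G (z + a) ∂(fakeLaw X K ε)) :=
        mul_le_mul hS h (integral_nonneg h0) (Real.exp_nonneg _)
    _ = _ := by rw [← mul_assoc, ← Real.exp_add]; simp

end Fake

/-! ### Offline oracles -/

section Oracle

variable {C : Type*} {K : ℕ} {P : Finset (Policy C K)} {M : List (Outcome C K) → Policy C K}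

@[simp] lemma cumLoss_nil (p : Policy C K) : cumLoss p [] = 0 := by simp [cumLoss]

lemma cumLoss_append (p : Policy C K) (y y' : List (Outcome C K)) :
    cumLoss p (y ++ y') = cumLoss p y + cumLoss p y' := by simp [cumLoss]

@[simp] lemma cumLoss_singleton (p : Policy C K) (o : Outcome C K) :
    cumLoss p [o] = actionLoss (p o.1) o.2 := by simp [cumLoss]

/-- Consistent tie-breaking makes the answer a function of the cumulative losses of the policies
alone. This allows an outcome to be traded for a shift of the noise even though the lists differ. -/
lemma IsOracle.congr (hM : IsOracle P M) {y y' : List (Outcome C K)}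
    (h : ∀ p ∈ P, cumLoss p y = cumLoss p y') : M y = M y' := by
  have h1 := hM.isMin y _ (hM.mem y')
  have h2 := hM.isMin y' _ (hM.mem y)
  have h3 := h _ (hM.mem y)
  have h4 := h _ (hM.mem y')
  apply hM.consistent <;> linarith

/-- If the loss of the leader `p` on `y` grows by at most as much as that of any policy
outside of a set, then the new leader belongs to that set. -/
lemma IsOracle.leader_mem (hM : IsOracle P M) {y y' : List (Outcome C K)} (Q : Policy C K → Prop)
    (hQ : Q (M y))
    (h : ∀ q ∈ P, ¬ Q q → cumLoss (M y) y' - cumLoss (M y) y ≤ cumLoss q y' - cumLoss q y) :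
    Q (M y') := by
  by_contra hq
  have h1 := hM.isMin y _ (hM.mem y')
  have h2 := hM.isMin y' _ (hM.mem y)
  have h3 := h _ (hM.mem y') hq
  have : M y = M y' := by apply hM.consistent <;> linarith
  exact hq (this ▸ hQ)

/-- The oracle prefers `p` to `q`: it returns `p` on some sequence on which `q` is optimal, too. -/
def Prefers (M : List (Outcome C K) → Policy C K) (p q : Policy C K) : Prop :=
  ∃ y, M y = p ∧ cumLoss q y = cumLoss p y

/-- No measurability of the oracle is assumed; it comes from this description by finitely many
inequalities and a fixed preference relation. For the converse, the policy `M y` is itself a rival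
tied with p, so p is preferred to it on some sequence, and consistency identifies the two. -/
lemma IsOracle.eq_iff (hM : IsOracle P M) (y : List (Outcome C K)) {p : Policy C K}
    (hp : p ∈ P) :
    M y = p ↔ ∀ q ∈ P, cumLoss p y ≤ cumLoss q y ∧
      (cumLoss q y = cumLoss p y → Prefers M p q) := by
  constructor
  · rintro rfl q hq
    exact ⟨hM.isMin y q hq, fun h => ⟨y, rfl, h⟩⟩
  · intro h
    have h1 := h _ (hM.mem y)
    have h2 := hM.isMin y p hp
    obtain ⟨y', hy', hyq⟩ := h1.2 (le_antisymm h2 h1.1)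
    have : M y = M y' := by
      apply hM.consistent
      · rw [hy']; linarith [h1.1]
      · rw [hy']; exact hyq
    rw [this, hy']

lemma IsOracle.measurableSet_eq (hM : IsOracle P M) {S : Type*} {_ : MeasurableSpace S}
    {y : S → List (Outcome C K)} (hy : ∀ p ∈ P, Measurable fun s => cumLoss p (y s))
    (p : Policy C K) : MeasurableSet {s | M (y s) = p} := by
  by_cases hp : p ∈ P
  · simp only [hM.eq_iff _ hp, Set.ofPred_forall, Set.ofPred_and]
    refine Finset.measurableSet_biInter _ fun q hq => ?_
    refine (measurableSet_le (hy p hp) (hy q hq)).inter ?_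
    by_cases hpq : Prefers M p q
    · simp [hpq]
    · simp only [hpq, imp_false]
      exact (measurableSet_eq_fun (hy q hq) (hy p hp)).compl
  · convert MeasurableSet.empty
    ext s
    simp only [Set.mem_ofPred_eq, Set.mem_empty_iff_false, iff_false]
    rintro rfl
    exact hp (hM.mem _)

lemma IsOracle.measurableSet_mem (hM : IsOracle P M)
    {S : Type*} {_ : MeasurableSpace S} {y : S → List (Outcome C K)}
    (hy : ∀ p ∈ P, Measurable fun s => cumLoss p (y s)) (Q : S → Policy C K → Prop)
    (hQ : ∀ p ∈ P, MeasurableSet {s | Q s p}) : MeasurableSet {s | Q s (M (y s))} := by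
  have : {s | Q s (M (y s))} = ⋃ p ∈ P, ({s | M (y s) = p} ∩ {s | Q s p}) := by
    ext s
    simp only [Set.mem_ofPred_eq, Set.mem_iUnion, Set.mem_inter_iff, exists_prop]
    constructor
    · intro h
      exact ⟨M (y s), hM.mem _, rfl, h⟩
    · rintro ⟨p, -, rfl, h⟩
      exact h
  rw [this]
  exact Finset.measurableSet_biUnion _ fun p hp => (hM.measurableSet_eq hy p).inter (hQ p hp)

/-- **Be the leader**: playing the leader for the sequence that includes the current outcome
incurs no regret. -/
lemma IsOracle.be_the_leader (hM : IsOracle P M) (y₀ : List (Outcome C K))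
    (h : ℕ → List (Outcome C K)) (x : ℕ → C) (l : ℕ → Fin K → ℝ) (h0 : h 0 = [])
    (hs : ∀ t, h (t + 1) = h t ++ [(x t, l t)]) (T : ℕ) :
    cumLoss (M y₀) y₀ + ∑ t ∈ Finset.range T, actionLoss (M (y₀ ++ h (t + 1)) (x t)) (l t)
      ≤ cumLoss (M (y₀ ++ h T)) (y₀ ++ h T) := by
  induction T with
  | zero => simp [h0]
  | succ T ih =>
    rw [Finset.sum_range_succ, ← add_assoc]
    -- The leader that includes round `T` competes with the leader that does not.
    have h1 := hM.isMin (y₀ ++ h T) _ (hM.mem (y₀ ++ h (T + 1)))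
    have h2 : cumLoss (M (y₀ ++ h (T + 1))) (y₀ ++ h (T + 1))
        = cumLoss (M (y₀ ++ h (T + 1))) (y₀ ++ h T)
          + actionLoss (M (y₀ ++ h (T + 1)) (x T)) (l T) := by
      conv_lhs => rw [cumLoss_append, hs, cumLoss_append, cumLoss_singleton]
      rw [cumLoss_append, ← hs]
      ring
    linarith

lemma cumLoss_eq_sum (p : Policy C K)
    (h : ℕ → List (Outcome C K)) (x : ℕ → C) (l : ℕ → Fin K → ℝ) (h0 : h 0 = [])
    (hs : ∀ t, h (t + 1) = h t ++ [(x t, l t)]) (T : ℕ) :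
    cumLoss p (h T) = ∑ t ∈ Finset.range T, actionLoss (p (x t)) (l t) := by
  induction T with
  | zero => simp [h0]
  | succ T ih => rw [Finset.sum_range_succ, hs, cumLoss_append, ih, cumLoss_singleton]

lemma actionLoss_nonneg {l : Fin K → ℝ} (hl : ∀ j, 0 ≤ l j) (a : Finset (Fin K)) :
    0 ≤ actionLoss a l := Finset.sum_nonneg fun j _ => hl j

lemma actionLoss_le_sum {l : Fin K → ℝ} (hl : ∀ j, 0 ≤ l j) (a : Finset (Fin K)) :
    actionLoss a l ≤ ∑ j, l j :=
  Finset.sum_le_sum_of_subset_of_nonneg (Finset.subset_univ a) fun j _ _ => hl j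

lemma actionLoss_eq_sum_indicator (a : Finset (Fin K)) (l : Fin K → ℝ) :
    actionLoss a l = ∑ j, if j ∈ a then l j else 0 := by
  simp [actionLoss]

end Oracle

/-! ### Perturbed leaders -/

section Fake

variable {C : Type*} {K : ℕ} {P : Finset (Policy C K)} {M : List (Outcome C K) → Policy C K}
  {X : Finset C}

lemma cumLoss_fakeSamples (p : Policy C K) (z : FakeLosses X K) :
    cumLoss p (fakeSamples X z) = ∑ x : {x // x ∈ X}, ∑ j, if j ∈ p x then z (x, j) else 0 := by
  simp only [cumLoss, fakeSamples, List.map_map, ← actionLoss_eq_sum_indicator]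
  rw [← Finset.univ_eq_attach, ← Finset.sum_map_toList]
  simp only [Function.comp_def]

lemma cumLoss_fakeSamples_add (p : Policy C K) (z a : FakeLosses X K) :
    cumLoss p (fakeSamples X (z + a))
      = cumLoss p (fakeSamples X z) + cumLoss p (fakeSamples X a) := by
  simp only [cumLoss_fakeSamples, ← Finset.sum_add_distrib]
  refine Finset.sum_congr rfl fun x _ => Finset.sum_congr rfl fun j _ => ?_
  split_ifs <;> simp

lemma measurable_cumLoss_fakeSamples (p : Policy C K) :
    Measurable fun z : FakeLosses X K => cumLoss p (fakeSamples X z) := by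
  simp only [cumLoss_fakeSamples]
  refine Finset.measurable_sum _ fun x _ => Finset.measurable_sum _ fun j _ => ?_
  split_ifs <;> fun_prop

/-- Fake losses that equal `l` in the context `x` and vanish elsewhere. -/
noncomputable def singleFake (X : Finset C) {K : ℕ} (x : C) (l : Fin K → ℝ) : FakeLosses X K :=
  open Classical in fun i => if i.1.1 = x then l i.2 else 0

lemma cumLoss_singleFake (p : Policy C K) {x : C} (hx : x ∈ X) (l : Fin K → ℝ) :
    cumLoss p (fakeSamples X (singleFake X x l)) = actionLoss (p x) l := by
  classical
  rw [cumLoss_fakeSamples, Finset.sum_eq_single ⟨x, hx⟩]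
  · simp [singleFake, actionLoss]
  · intro y _ hy
    have : y.1 ≠ x := fun h => hy (Subtype.ext h)
    simp [singleFake, this]
  · simp

lemma sum_abs_singleFake {x : C} (hx : x ∈ X) (l : Fin K → ℝ) :
    ∑ i, |singleFake X x l i| = ∑ j, |l j| := by
  classical
  rw [Fintype.sum_prod_type, Finset.sum_eq_single ⟨x, hx⟩]
  · simp [singleFake]
  · intro y _ hy
    have : y.1 ≠ x := fun h => hy (Subtype.ext h)
    simp [singleFake, this]
  · simp

lemma IsOracle.measurableSet_ftplPolicy (hM : IsOracle P M)
    {S : Type*} {_ : MeasurableSpace S} {h : S → List (Outcome C K)}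
    (hh : ∀ p ∈ P, Measurable fun s => cumLoss p (h s)) {z : S → FakeLosses X K}
    (hz : Measurable z) (Q : S → Policy C K → Prop)
    (hQ : ∀ p ∈ P, MeasurableSet {s | Q s p}) :
    MeasurableSet {s | Q s (ftplPolicy M X (h s) (z s))} := by
  refine hM.measurableSet_mem (fun p hp => ?_) Q hQ
  simp only [cumLoss_append]
  exact ((measurable_cumLoss_fakeSamples p).comp hz).add (hh p hp)

lemma IsOracle.measurableSet_ftplPolicy_const (hM : IsOracle P M) (h : List (Outcome C K))
    (Q : Policy C K → Prop) :
    MeasurableSet {z : FakeLosses X K | Q (ftplPolicy M X h z)} :=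
  hM.measurableSet_ftplPolicy (h := fun _ => h) (fun _ _ => measurable_const) measurable_id
    (fun _ => Q) fun _ _ => MeasurableSet.const _

lemma IsOracle.measurable_ftplPolicy_comp (hM : IsOracle P M) (h : List (Outcome C K))
    (f : Policy C K → ℝ) :
    Measurable fun z : FakeLosses X K => f (ftplPolicy M X h z) := by
  intro s _
  exact hM.measurableSet_ftplPolicy_const h fun p => f p ∈ s

lemma IsOracle.integrable_ftplPolicy_comp (hM : IsOracle P M) (h : List (Outcome C K))
    (f : Policy C K → ℝ) {ε : ℝ} (hε : 0 < ε) :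
    Integrable (fun z : FakeLosses X K => f (ftplPolicy M X h z)) (fakeLaw X K ε) := by
  have := isProbabilityMeasure_fakeLaw X K hε
  refine Integrable.of_bound (hM.measurable_ftplPolicy_comp h f).aestronglyMeasurable
    (∑ p ∈ P, ‖f p‖) (Filter.Eventually.of_forall fun z => ?_)
  exact Finset.single_le_sum (f := fun p => ‖f p‖) (fun p _ => norm_nonneg _) (hM.mem _)

/-- The probability that the perturbed leader selects the coordinate `j` in the context `x`. -/
noncomputable def selProb (M : List (Outcome C K) → Policy C K) (X : Finset C) (ε : ℝ)
    (h : List (Outcome C K)) (x : C) (j : Fin K) : ℝ :=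
  (fakeLaw X K ε).real {z | j ∈ ftplPolicy M X h z x}

/-- The expected loss sees the leader only through its marginals, which is why the learner can be
charged Σ_j q_j l_j in the analysis. -/
lemma IsOracle.integral_actionLoss_ftplPolicy (hM : IsOracle P M) (h : List (Outcome C K)) {ε : ℝ}
    (hε : 0 < ε) (x : C) (l : Fin K → ℝ) :
    ∫ z, actionLoss (ftplPolicy M X h z x) l ∂(fakeLaw X K ε)
      = ∑ j, selProb M X ε h x j * l j := by
  simp only [actionLoss_eq_sum_indicator]
  rw [integral_finsetSum]
  · refine Finset.sum_congr rfl fun j _ => ?_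
    have h1 : ∀ z : FakeLosses X K, (if j ∈ ftplPolicy M X h z x then l j else 0)
        = {z | j ∈ ftplPolicy M X h z x}.indicator (fun _ => l j) z := fun z => by
      simp [Set.indicator_apply]
    simp only [h1]
    rw [integral_indicator_const _ (hM.measurableSet_ftplPolicy_const h fun p => j ∈ p x)]
    rfl
  · intro j _
    exact hM.integrable_ftplPolicy_comp h (fun p => if j ∈ p x then l j else 0) hε

/-! ### Stability -/

/-- Stability in the transductive setting: a further outcome amounts to a shift of the noise. -/
lemma IsOracle.stability_transductive (hM : IsOracle P M) (h : List (Outcome C K)) {ε : ℝ}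
    (hε : 0 < ε) {x : C} (hx : x ∈ X) {l : Fin K → ℝ} (hl : ∀ j, 0 ≤ l j) :
    ∫ z, (actionLoss (ftplPolicy M X h z x) l
        - actionLoss (ftplPolicy M X (h ++ [(x, l)]) z x) l) ∂(fakeLaw X K ε)
      ≤ ε * (∑ j, l j) * ∑ j, selProb M X ε h x j * l j := by
  have hshift : ∀ z : FakeLosses X K,
      ftplPolicy M X (h ++ [(x, l)]) z = ftplPolicy M X h (z + singleFake X x l) := by
    intro z
    refine hM.congr fun p _ => ?_
    simp only [cumLoss_append, cumLoss_fakeSamples_add, cumLoss_singleFake p hx,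
      cumLoss_singleton]
    ring
  have key := integral_le_integral_shift hε (singleFake X x l)
    (hM.measurable_ftplPolicy_comp h fun p => actionLoss (p x) l)
    (fun z => actionLoss_nonneg hl _) (fun z => actionLoss_le_sum hl _)
  rw [sum_abs_singleFake hx] at key
  simp only [abs_of_nonneg (hl _)] at key
  rw [integral_sub (hM.integrable_ftplPolicy_comp h (fun p => actionLoss (p x) l) hε)
    (hM.integrable_ftplPolicy_comp _ (fun p => actionLoss (p x) l) hε),
    ← hM.integral_actionLoss_ftplPolicy h hε]
  simp only [hshift]
  linarith

/-- The part of `A` that survives the shift lies in `A ∩ B`, so `A \ B` has at most the mass that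
`A` loses under the shift, which is at most ε ‖a‖₁ times the mass of `A`. -/
lemma measureReal_diff_le_of_shift {ε : ℝ} (hε : 0 < ε) (a : FakeLosses X K)
    {A B : Set (FakeLosses X K)} (hA : MeasurableSet A) (hB : MeasurableSet B)
    (hAA : ∀ z, z + a ∈ A → z ∈ A) (hAB : ∀ z, z + a ∈ A → z ∈ B) :
    (fakeLaw X K ε).real (A \ B) ≤ ε * ∑ i, |a i| := by
  have := isProbabilityMeasure_fakeLaw X K hε
  have key := integral_le_integral_shift hε a (measurable_one.indicator hA)
    (fun z => Set.indicator_nonneg (fun _ _ => zero_le_one) z)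
    (b := 1) (fun z => Set.indicator_le_self' (fun _ _ => zero_le_one) z)
  have h1 : ∫ z, A.indicator (1 : FakeLosses X K → ℝ) z ∂(fakeLaw X K ε)
      = (fakeLaw X K ε).real A := integral_indicator_one hA
  have h2 : ∫ z, A.indicator (1 : FakeLosses X K → ℝ) (z + a) ∂(fakeLaw X K ε)
      = (fakeLaw X K ε).real ((fun z => z + a) ⁻¹' A) :=
    integral_indicator_one (hA.preimage (by fun_prop : Measurable fun z => z + a))
  have h3 : (fakeLaw X K ε).real ((fun z => z + a) ⁻¹' A) ≤ (fakeLaw X K ε).real (A ∩ B) :=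
    measureReal_mono fun z hz => ⟨hAA z hz, hAB z hz⟩
  have h4 : (fakeLaw X K ε).real (A ∩ B) + (fakeLaw X K ε).real (A \ B)
      = (fakeLaw X K ε).real A := measureReal_inter_add_sdiff hB
  have h5 : (fakeLaw X K ε).real A ≤ 1 := measureReal_le_one
  have h6 : 0 ≤ ε * ∑ i, |a i| := mul_nonneg hε.le (Finset.sum_nonneg fun _ _ => abs_nonneg _)
  rw [h1, h2] at key
  nlinarith

/-- Penalize the pair (x, j) by `B`. A leader that selects j in spite of the penalty has a margin of
`B` over all policies that avoid j at x; without the penalty it still selects j there, and a change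
of relative losses by at most `B` from `h` to `h'` cannot take j away. Ties are settled by
`IsOracle.leader_mem`. -/
lemma IsOracle.measureReal_leader_changes_le (hM : IsOracle P M) {h h' : List (Outcome C K)}
    {ε B : ℝ} (hε : 0 < ε) (hB : 0 ≤ B) {x : C} (hx : x ∈ X) (j : Fin K)
    (hhh : ∀ p ∈ P, ∀ q ∈ P,
      cumLoss p h' - cumLoss p h ≤ cumLoss q h' - cumLoss q h + B) :
    (fakeLaw X K ε).real {z | j ∈ ftplPolicy M X h z x ∧ j ∉ ftplPolicy M X h' z x}
      ≤ ε * B := by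
  classical
  have hsum : ∑ i, |singleFake X x (Pi.single j B) i| = B := by
    rw [sum_abs_singleFake hx, Finset.sum_eq_single j]
    · simp [abs_of_nonneg hB]
    · intro k _ hk; simp [hk]
    · simp
  have hal : ∀ p : Policy C K, actionLoss (p x) (Pi.single j B) = if j ∈ p x then B else 0 := by
    intro p; simp [actionLoss]
  conv_rhs => rw [← hsum]
  refine measureReal_diff_le_of_shift hε (singleFake X x (Pi.single j B))
    (hM.measurableSet_ftplPolicy_const h fun p => j ∈ p x)
    (hM.measurableSet_ftplPolicy_const h' fun p => j ∈ p x) ?_ ?_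
  · intro z hz
    refine hM.leader_mem (fun p => j ∈ p x) hz fun q hq hjq => ?_
    have hz' : j ∈ M (fakeSamples X (z + singleFake X x (Pi.single j B)) ++ h) x := hz
    simp only [cumLoss_append, cumLoss_fakeSamples_add, cumLoss_singleFake _ hx, hal, if_pos hz',
      if_neg hjq]
    linarith
  · intro z hz
    refine hM.leader_mem (fun p => j ∈ p x) hz fun q hq hjq => ?_
    have hz' : j ∈ M (fakeSamples X (z + singleFake X x (Pi.single j B)) ++ h) x := hz
    have := hhh _ (hM.mem (fakeSamples X (z + singleFake X x (Pi.single j B)) ++ h)) q hq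
    simp only [cumLoss_append, cumLoss_fakeSamples_add, cumLoss_singleFake _ hx, hal, if_pos hz',
      if_neg hjq]
    linarith

/-- Stability in the small separator setting: the leader changes only if one of its decisions
on the separator changes. -/
lemma IsOracle.stability_separator (hM : IsOracle P M) (hX : IsSeparator P X)
    (h : List (Outcome C K)) {ε : ℝ} (hε : 0 < ε) (x : C) {l : Fin K → ℝ} (hl : ∀ j, 0 ≤ l j) :
    ∫ z, (actionLoss (ftplPolicy M X h z x) l
        - actionLoss (ftplPolicy M X (h ++ [(x, l)]) z x) l) ∂(fakeLaw X K ε)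
      ≤ 2 * ε * X.card * K * (∑ j, l j) ^ 2 := by
  have := isProbabilityMeasure_fakeLaw X K hε
  set h' := h ++ [(x, l)] with hh'
  set B := ∑ j, l j with hBdef
  have hB : 0 ≤ B := Finset.sum_nonneg fun j _ => hl j
  set D : {x // x ∈ X} × Fin K → Set (FakeLosses X K) := fun i =>
    {z | i.2 ∈ ftplPolicy M X h z i.1 ∧ i.2 ∉ ftplPolicy M X h' z i.1} ∪
    {z | i.2 ∈ ftplPolicy M X h' z i.1 ∧ i.2 ∉ ftplPolicy M X h z i.1} with hD
  have hdiff : ∀ p : Policy C K, cumLoss p h' - cumLoss p h = actionLoss (p x) l := by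
    intro p; simp [hh', cumLoss_append]
  have hDB : ∀ i, (fakeLaw X K ε).real (D i) ≤ 2 * (ε * B) := by
    intro i
    refine (measureReal_union_le _ _).trans ?_
    rw [two_mul]
    -- The new outcome adds between 0 and `B` to the loss of every policy, so relative losses move
    -- by at most `B`, both from `h` to `h'` and back.
    refine add_le_add (hM.measureReal_leader_changes_le hε hB i.1.2 i.2 fun p _ q _ => ?_)
      (hM.measureReal_leader_changes_le hε hB i.1.2 i.2 fun p _ q _ => ?_)
    · rw [hdiff, hdiff]
      linarith [actionLoss_le_sum hl (p x), actionLoss_nonneg hl (q x)]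
    · have h1 := hdiff p
      have h2 := hdiff q
      linarith [actionLoss_le_sum hl (q x), actionLoss_nonneg hl (p x)]
  have hDm : ∀ i, MeasurableSet (D i) := fun i =>
    ((hM.measurableSet_ftplPolicy_const h fun p => i.2 ∈ p i.1).inter
      (hM.measurableSet_ftplPolicy_const h' fun p => i.2 ∈ p i.1).compl).union
    ((hM.measurableSet_ftplPolicy_const h' fun p => i.2 ∈ p i.1).inter
      (hM.measurableSet_ftplPolicy_const h fun p => i.2 ∈ p i.1).compl)
  -- Outside the union both leaders agree on all of X and are therefore equal, since X is a
  -- separator. Inside it, the difference of two losses is at most the total `B`.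
  have hpt : ∀ z : FakeLosses X K, actionLoss (ftplPolicy M X h z x) l
      - actionLoss (ftplPolicy M X h' z x) l ≤ (⋃ i, D i).indicator (fun _ => B) z := by
    intro z
    by_cases hz : z ∈ ⋃ i, D i
    · rw [Set.indicator_of_mem hz]
      linarith [actionLoss_le_sum hl (ftplPolicy M X h z x),
        actionLoss_nonneg hl (ftplPolicy M X h' z x)]
    · rw [Set.indicator_of_notMem hz]
      have : ftplPolicy M X h z = ftplPolicy M X h' z := by
        by_contra hne
        obtain ⟨y, hy, hyne⟩ := hX _ (hM.mem _) _ (hM.mem _) hne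
        refine hyne (Finset.ext fun j => ?_)
        have hj : z ∉ D (⟨y, hy⟩, j) := fun hzj => hz (Set.mem_iUnion_of_mem _ hzj)
        simp only [hD, Set.mem_union, Set.mem_ofPred_eq, not_or, not_and, not_not] at hj
        exact ⟨hj.1, hj.2⟩
      rw [this, sub_self]
  have hUm : MeasurableSet (⋃ i, D i) := MeasurableSet.iUnion hDm
  have hU : (fakeLaw X K ε).real (⋃ i, D i) ≤ X.card * K * (2 * (ε * B)) := by
    refine (measureReal_iUnion_fintype_le _).trans ((Finset.sum_le_sum fun i _ => hDB i).trans ?_)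
    simp
  calc _ ≤ ∫ z, (⋃ i, D i).indicator (fun _ => B) z ∂(fakeLaw X K ε) := by
        refine integral_mono ((hM.integrable_ftplPolicy_comp h (fun p => actionLoss (p x) l) hε).sub
          (hM.integrable_ftplPolicy_comp h' (fun p => actionLoss (p x) l) hε))
          ((integrable_const B).indicator hUm) hpt
    _ = (fakeLaw X K ε).real (⋃ i, D i) * B := by
        rw [integral_indicator_const _ hUm, smul_eq_mul]
    _ ≤ (X.card * K * (2 * (ε * B))) * B := by gcongr
    _ = _ := by ring

end Fake

/-! ### The cost of the perturbation -/

section Noise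

variable {C : Type*} {K : ℕ} {P : Finset (Policy C K)} {M : List (Outcome C K) → Policy C K}
  {X : Finset C}

lemma exp_cumLoss_fakeSamples (p : Policy C K) (s : ℝ) (z : FakeLosses X K) :
    Real.exp (s * cumLoss p (fakeSamples X z))
      = ∏ i, (if i.2 ∈ p i.1 then Real.exp (s * z i) else 1) := by
  rw [cumLoss_fakeSamples, ← Fintype.sum_prod_type (f := fun i : {x // x ∈ X} × Fin K =>
    if i.2 ∈ p i.1 then z i else 0), Finset.mul_sum, Real.exp_sum]
  refine Finset.prod_congr rfl fun i _ => ?_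
  split_ifs <;> simp

lemma integrable_exp_cumLoss_fakeSamples (p : Policy C K) {ε s : ℝ} (hs : |s| < ε) :
    Integrable (fun z => Real.exp (s * cumLoss p (fakeSamples X z))) (fakeLaw X K ε) := by
  have := isProbabilityMeasure_laplace ((abs_nonneg s).trans_lt hs)
  simp only [exp_cumLoss_fakeSamples]
  refine Integrable.fintype_prod (f := fun (i : {x // x ∈ X} × Fin K) (z : ℝ) =>
    if i.2 ∈ p i.1 then Real.exp (s * z) else 1) fun i => ?_
  split_ifs
  · exact integrable_exp_mul_laplace hs
  · exact integrable_const _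

/-- The policy collects noise from at most m coordinates in each context of X, so at most |X| m
independent factors differ from 1. -/
lemma integral_exp_cumLoss_fakeSamples_le (p : Policy C K) {m : ℕ} (hm : ∀ x, (p x).card ≤ m)
    {ε θ : ℝ} (hε : 0 < ε) (hθ : θ ^ 2 ≤ 1 / 4) :
    ∫ z, Real.exp (ε * θ * cumLoss p (fakeSamples X z)) ∂(fakeLaw X K ε)
      ≤ Real.exp (2 * θ ^ 2 * (X.card * m)) := by
  have := isProbabilityMeasure_laplace hε
  simp only [exp_cumLoss_fakeSamples]
  unfold fakeLaw
  rw [integral_fintype_prod_eq_prod (f := fun (i : {x // x ∈ X} × Fin K) (z : ℝ) =>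
    if i.2 ∈ p i.1 then Real.exp (ε * θ * z) else 1)]
  calc _ ≤ ∏ i : {x // x ∈ X} × Fin K, (if i.2 ∈ p i.1 then Real.exp (2 * θ ^ 2) else 1) := by
        refine Finset.prod_le_prod (fun i _ => integral_nonneg fun z => ?_) fun i _ => ?_
        · simp only [Pi.zero_apply]; split_ifs <;> positivity
        · split_ifs
          · exact integral_exp_mul_laplace_le hε hθ
          · simp
    _ = Real.exp (2 * θ ^ 2 * ∑ x : {x // x ∈ X}, ((p x).card : ℝ)) := by
        rw [Fintype.prod_prod_type, Finset.mul_sum, Real.exp_sum]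
        refine Finset.prod_congr rfl fun x _ => ?_
        simp only
        rw [Finset.prod_ite_mem, Finset.univ_inter, Finset.prod_const, ← Real.exp_nat_mul, mul_comm]
    _ ≤ _ := by
        gcongr
        refine (Finset.sum_le_sum fun x _ => Nat.cast_le.2 (hm x.1)).trans ?_
        simp

lemma integrable_eval_fakeLaw {ε : ℝ} (hε : 0 < ε) (i : {x // x ∈ X} × Fin K) :
    Integrable (fun z : FakeLosses X K => z i) (fakeLaw X K ε) := by
  have := isProbabilityMeasure_laplace hε
  exact (measurePreserving_eval (fun _ : {x // x ∈ X} × Fin K => laplace ε) i).integrable_comp_of_integrable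
    (integrable_id_laplace hε)

lemma integral_eval_fakeLaw {ε : ℝ} (hε : 0 < ε) (i : {x // x ∈ X} × Fin K) :
    ∫ z : FakeLosses X K, z i ∂(fakeLaw X K ε) = 0 := by
  have := isProbabilityMeasure_laplace hε
  unfold fakeLaw
  rw [integral_comp_eval (μ := fun _ : {x // x ∈ X} × Fin K => laplace ε) (i := i)
    (f := fun z : ℝ => z) (by fun_prop), integral_id_laplace hε]

lemma integrable_cumLoss_fakeSamples (p : Policy C K) {ε : ℝ} (hε : 0 < ε) :
    Integrable (fun z => cumLoss p (fakeSamples X z)) (fakeLaw X K ε) := by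
  have := isProbabilityMeasure_fakeLaw X K hε
  simp only [cumLoss_fakeSamples]
  refine integrable_finsetSum _ fun x _ => integrable_finsetSum _ fun j _ => ?_
  split_ifs
  · exact integrable_eval_fakeLaw hε _
  · exact integrable_const _

lemma integral_cumLoss_fakeSamples (p : Policy C K) {ε : ℝ} (hε : 0 < ε) :
    ∫ z, cumLoss p (fakeSamples X z) ∂(fakeLaw X K ε) = 0 := by
  have := isProbabilityMeasure_fakeLaw X K hε
  have h : ∀ (x : {x // x ∈ X}) (j : Fin K),
      Integrable (fun z : FakeLosses X K => if j ∈ p x then z (x, j) else 0) (fakeLaw X K ε) := by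
    intro x j
    split_ifs
    · exact integrable_eval_fakeLaw hε _
    · exact integrable_const _
  simp only [cumLoss_fakeSamples]
  rw [integral_finsetSum _ fun x _ => integrable_finsetSum _ fun j _ => h x j]
  refine Finset.sum_eq_zero fun x _ => ?_
  rw [integral_finsetSum _ fun j _ => h x j]
  refine Finset.sum_eq_zero fun j _ => ?_
  split_ifs
  · exact integral_eval_fakeLaw hε _
  · simp

lemma IsOracle.integrable_cumLoss_ftplPolicy (hM : IsOracle P M) (h : List (Outcome C K))
    {ε : ℝ} (hε : 0 < ε) :
    Integrable (fun z => cumLoss (ftplPolicy M X h z) (fakeSamples X z)) (fakeLaw X K ε) := by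
  classical
  have h1 : (fun z => cumLoss (ftplPolicy M X h z) (fakeSamples X z)) = fun z => ∑ p ∈ P,
      {z | ftplPolicy M X h z = p}.indicator (fun z => cumLoss p (fakeSamples X z)) z := by
    funext z
    rw [Finset.sum_eq_single (ftplPolicy M X h z)]
    · simp
    · intro p _ hp
      rw [Set.indicator_of_notMem]
      exact fun h => hp h.symm
    · intro hp
      exact absurd (hM.mem _) hp
  rw [h1]
  exact integrable_finsetSum _ fun p _ => (integrable_cumLoss_fakeSamples p hε).indicator
    (hM.measurableSet_ftplPolicy_const h fun q => q = p)

/-- The expected loss on the noise that the perturbed leader gains over a fixed policy is at most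
`(log N + 2 θ² d m) / (ε θ)`. -/
lemma IsOracle.integral_noise_le_aux (hM : IsOracle P M) {m : ℕ}
    (hm : ∀ p ∈ P, ∀ x, (p x).card ≤ m) {ε θ : ℝ} (hε : 0 < ε) (hθ0 : 0 < θ)
    (hθ : θ ^ 2 ≤ 1 / 4) :
    ε * θ * ∫ z, -cumLoss (ftplPolicy M X [] z) (fakeSamples X z) ∂(fakeLaw X K ε)
      ≤ Real.log P.card + 2 * θ ^ 2 * (X.card * m) := by
  have := isProbabilityMeasure_fakeLaw X K hε
  have hN : 0 < (P.card : ℝ) := Nat.cast_pos.2 (Finset.card_pos.2 ⟨_, hM.mem []⟩)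
  set E := Real.exp (2 * θ ^ 2 * (X.card * m)) with hE
  have hE0 : 0 < E := Real.exp_pos _
  -- `A` bounds the expectation of the sum over P of the exponentials, so the quotient below has
  -- mean at most 1.
  set A := P.card * E with hA
  have hA0 : 0 < A := mul_pos hN hE0
  have hlog : Real.log A = Real.log P.card + 2 * θ ^ 2 * (X.card * m) := by
    rw [hA, Real.log_mul hN.ne' hE0.ne', hE, Real.log_exp]
  have ht : |ε * -θ| < ε := by
    rw [abs_mul, abs_of_pos hε, abs_neg, abs_of_pos hθ0]
    have : θ < 1 := by nlinarith
    nlinarith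
  have hi : Integrable (fun z => Real.log A - 1 + (∑ p ∈ P,
      Real.exp (ε * -θ * cumLoss p (fakeSamples X z))) / A) (fakeLaw X K ε) :=
    (integrable_const _).add ((integrable_finsetSum _ fun p _ =>
      integrable_exp_cumLoss_fakeSamples p ht).div_const _)
  -- The tangent bound u ≤ log A - 1 + exp(u) / A replaces Jensen's inequality for the logarithm,
  -- and exp(u) for the leader is one term of the sum over P.
  have hpt : ∀ z : FakeLosses X K, ε * θ * -cumLoss (ftplPolicy M X [] z) (fakeSamples X z)
      ≤ Real.log A - 1 + (∑ p ∈ P, Real.exp (ε * -θ * cumLoss p (fakeSamples X z))) / A := by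
    intro z
    set u := ε * -θ * cumLoss (ftplPolicy M X [] z) (fakeSamples X z) with hu
    have h1 : Real.exp u ≤ ∑ p ∈ P, Real.exp (ε * -θ * cumLoss p (fakeSamples X z)) :=
      Finset.single_le_sum (f := fun p => Real.exp (ε * -θ * cumLoss p (fakeSamples X z)))
        (fun p _ => (Real.exp_pos _).le) (hM.mem _)
    have h2 : Real.exp (u - Real.log A) = Real.exp u / A := by
      rw [Real.exp_sub, Real.exp_log hA0]
    have h3 := Real.add_one_le_exp (u - Real.log A)
    have h4 : Real.exp u / A
        ≤ (∑ p ∈ P, Real.exp (ε * -θ * cumLoss p (fakeSamples X z))) / A := by gcongr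
    have h5 : ε * θ * -cumLoss (ftplPolicy M X [] z) (fakeSamples X z) = u := by rw [hu]; ring
    linarith
  rw [← integral_const_mul]
  refine (integral_mono ((hM.integrable_cumLoss_ftplPolicy [] hε).neg.const_mul _) hi hpt).trans ?_
  rw [integral_add (integrable_const _) ((integrable_finsetSum _ fun p _ =>
      integrable_exp_cumLoss_fakeSamples p ht).div_const _), integral_div,
    integral_finsetSum _ fun p _ => integrable_exp_cumLoss_fakeSamples p ht]
  have hsum : ∑ p ∈ P, ∫ z, Real.exp (ε * -θ * cumLoss p (fakeSamples X z)) ∂(fakeLaw X K ε)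
      ≤ A := by
    refine (Finset.sum_le_sum fun p hp => integral_exp_cumLoss_fakeSamples_le p (hm p hp) hε
      (θ := -θ) (by rwa [neg_sq])).trans (le_of_eq ?_)
    simp [hA, hE]
  have : (∑ p ∈ P, ∫ z, Real.exp (ε * -θ * cumLoss p (fakeSamples X z)) ∂(fakeLaw X K ε)) / A
      ≤ 1 := (div_le_one hA0).2 hsum
  simp only [integral_const, probReal_univ, smul_eq_mul, one_mul]
  linarith

lemma cumLoss_fakeSamples_eq_zero (p : Policy C K) {m : ℕ} (hm : ∀ x, (p x).card ≤ m)
    (h : X.card * m = 0) (z : FakeLosses X K) : cumLoss p (fakeSamples X z) = 0 := by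
  rw [cumLoss_fakeSamples]
  refine Finset.sum_eq_zero fun x _ => Finset.sum_eq_zero fun j _ => ?_
  have hX : X.card ≠ 0 := Finset.card_ne_zero_of_mem x.2
  have hm0 : m = 0 := by simpa [hX] using h
  have : p x = ∅ := by simpa [hm0] using hm x
  simp [this]

/-- The cost of the perturbation. -/
lemma IsOracle.integral_noise_le (hM : IsOracle P M) {m : ℕ}
    (hm : ∀ p ∈ P, ∀ x, (p x).card ≤ m) {ε : ℝ} (hε : 0 < ε) {p : Policy C K} (hp : p ∈ P) :
    ∫ z, (cumLoss p (fakeSamples X z) - cumLoss (ftplPolicy M X [] z) (fakeSamples X z))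
        ∂(fakeLaw X K ε)
      ≤ 10 / ε * √((X.card : ℝ) * m) * Real.log P.card := by
  have hpos : 0 ≤ 10 / ε * √((X.card : ℝ) * m) * Real.log P.card := by
    have := Real.log_natCast_nonneg P.card
    positivity
  -- Without visible noise, or with a single policy, the left side vanishes. Otherwise dm ≥ 1 and
  -- log N ≥ 1/2, as the choice of θ and the absorption of constants require.
  by_cases hdm : X.card * m = 0
  · simpa [cumLoss_fakeSamples_eq_zero p (hm p hp) hdm,
      fun z => cumLoss_fakeSamples_eq_zero (ftplPolicy M X [] z) (hm _ (hM.mem _)) hdm z] using hpos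
  by_cases hN : P.card ≤ 1
  · have : ∀ z : FakeLosses X K, ftplPolicy M X [] z = p := fun z =>
      Finset.card_le_one.1 hN _ (hM.mem _) _ hp
    simpa [this] using hpos
  rw [integral_sub (integrable_cumLoss_fakeSamples p hε) (hM.integrable_cumLoss_ftplPolicy [] hε),
    integral_cumLoss_fakeSamples p hε, zero_sub, ← integral_neg]
  have hdm1 : (1 : ℝ) ≤ (X.card : ℝ) * m := by exact_mod_cast Nat.one_le_iff_ne_zero.2 hdm
  set D := (X.card : ℝ) * m with hD
  have hs : 1 ≤ √D := Real.one_le_sqrt.2 hdm1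
  have hs2 : √D ^ 2 = D := Real.sq_sqrt (by linarith)
  have hlog : 1 / 2 ≤ Real.log P.card := by
    have h2 : (2 : ℝ) ≤ P.card := by exact_mod_cast (by omega : 2 ≤ P.card)
    have := Real.log_le_log (by norm_num) h2
    have h3 := Real.log_two_gt_d9
    norm_num at h3
    linarith
  have hθ2 : (1 / (2 * √D)) ^ 2 = 1 / (4 * D) := by rw [div_pow, mul_pow, hs2]; norm_num
  -- With θ = 1 / (2√(dm)) the term 2 θ² dm equals 1/2. Dividing by εθ gives the factor 2√(dm) / ε,
  -- and log N + 1/2 ≤ 5 log N leads to the constant 10.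
  have key := hM.integral_noise_le_aux (X := X) hm hε (θ := 1 / (2 * √D)) (by positivity) (by
    rw [hθ2]
    exact one_div_le_one_div_of_le (by norm_num) (by linarith))
  rw [hθ2, ← hD] at key
  have h1 : 2 * (1 / (4 * D)) * D = 1 / 2 := by
    have : D ≠ 0 := by linarith
    field_simp; norm_num
  rw [h1] at key
  set I := ∫ z, -cumLoss (ftplPolicy M X [] z) (fakeSamples X z) ∂(fakeLaw X K ε)
  have h2 : I = 2 * √D / ε * (ε * (1 / (2 * √D)) * I) := by
    field_simp
  rw [h2]
  have hc : 0 ≤ 2 * √D / ε := div_nonneg (mul_nonneg zero_le_two (Real.sqrt_nonneg _)) hε.le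
  calc _ ≤ 2 * √D / ε * (Real.log P.card + 1 / 2) := mul_le_mul_of_nonneg_left key hc
    _ ≤ 2 * √D / ε * (5 * Real.log P.card) := mul_le_mul_of_nonneg_left (by linarith) hc
    _ = _ := by ring

end Noise

/-! ### Truncated geometric resampling -/

lemma sum_range_ite_lt {n L : ℕ} (hn : n ≤ L) (f : ℕ → ℝ) :
    ∑ k ∈ Finset.range L, (if k < n then f k else 0) = ∑ k ∈ Finset.range n, f k := by
  rw [← Finset.sum_filter]
  congr 1
  ext k
  simp only [Finset.mem_filter, Finset.mem_range]
  omega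

lemma sum_range_odd (n : ℕ) : ∑ k ∈ Finset.range n, (2 * (k : ℝ) + 1) = (n : ℝ) ^ 2 := by
  induction n with
  | zero => simp
  | succ n ih => rw [Finset.sum_range_succ, ih]; push_cast; ring

lemma mul_geom_sum_one_sub (q : ℝ) (L : ℕ) :
    q * ∑ k ∈ Finset.range L, (1 - q) ^ k = 1 - (1 - q) ^ L := by
  have := mul_neg_geom_sum (1 - q) L
  rwa [sub_sub_cancel] at this

/-- The odd numbers turn the tail sum of a truncated geometric variable into its second moment.
Keeping the factor q² on the left avoids division, so q = 0 needs no separate treatment. -/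
lemma sq_mul_sum_odd_mul_pow (q : ℝ) (L : ℕ) :
    q ^ 2 * ∑ k ∈ Finset.range L, (2 * (k : ℝ) + 1) * (1 - q) ^ k
      = 2 - q - (1 - q) ^ L * (2 * L * q + 2 - q) := by
  induction L with
  | zero => simp
  | succ L ih => rw [Finset.sum_range_succ, mul_add, ih, pow_succ]; push_cast; ring

lemma sq_mul_sum_odd_mul_pow_le {q : ℝ} (hq0 : 0 ≤ q) (hq1 : q ≤ 1) (L : ℕ) :
    q ^ 2 * ∑ k ∈ Finset.range L, (2 * (k : ℝ) + 1) * (1 - q) ^ k ≤ 2 := by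
  rw [sq_mul_sum_odd_mul_pow]
  have h1 : 0 ≤ (1 - q) ^ L := pow_nonneg (by linarith) _
  have h2 : 0 ≤ 2 * L * q + 2 - q := by
    have : 0 ≤ (L : ℝ) * q := by positivity
    linarith
  nlinarith [mul_nonneg h1 h2]

/-- `q (1 - q) ^ L ≤ 1 / (e L)`. -/
lemma mul_one_sub_pow_le {q : ℝ} (hq0 : 0 ≤ q) (hq1 : q ≤ 1) {L : ℕ} (hL : 1 ≤ L) :
    q * (1 - q) ^ L ≤ 1 / (Real.exp 1 * L) := by
  have hL0 : (0 : ℝ) < L := by exact_mod_cast hL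
  -- Two tangent bounds are combined: 1 - q ≤ exp(-q), and s ≤ exp(s - 1) at s = Lq.
  have h1 : (1 - q) ^ L ≤ Real.exp (-(L * q)) := by
    rw [← mul_neg, Real.exp_nat_mul]
    exact pow_le_pow_left₀ (by linarith) (by linarith [Real.add_one_le_exp (-q)]) _
  have h2 : L * q ≤ Real.exp (L * q - 1) := by linarith [Real.add_one_le_exp (L * q - 1)]
  have h3 : Real.exp (-(L * q)) * Real.exp (L * q - 1) = 1 / Real.exp 1 := by
    rw [← Real.exp_add, one_div, ← Real.exp_neg]; ring_nf
  calc q * (1 - q) ^ L ≤ q * Real.exp (-(L * q)) := by gcongr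
    _ = (Real.exp (-(L * q)) * (L * q)) / L := by field_simp
    _ ≤ (Real.exp (-(L * q)) * Real.exp (L * q - 1)) / L := by gcongr
    _ = _ := by rw [h3]; field_simp

section Resample

variable {C : Type*} {K L : ℕ} {P : Finset (Policy C K)} {M : List (Outcome C K) → Policy C K}
  {X : Finset C}

lemma resampleCount_le (h : List (Outcome C K)) (w : Fin K × Fin L → FakeLosses X K) (x : C)
    (j : Fin K) : resampleCount M X h w x j ≤ L := Nat.sInf_le (by simp)

/-- Counts start at 1 and indices at 0, so a count above k means that the draws 0, …, k - 1 all
fail. Since k < L, the default value L is consistent with this. -/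
lemma lt_resampleCount_iff (h : List (Outcome C K)) (w : Fin K × Fin L → FakeLosses X K) (x : C)
    (j : Fin K) {k : ℕ} (hk : k < L) :
    k < resampleCount M X h w x j ↔
      ∀ i : Fin L, (i : ℕ) < k → j ∉ ftplPolicy M X h (w (j, i)) x := by
  have hne : ({n : ℕ | ∃ i : Fin L, n = (i : ℕ) + 1 ∧ j ∈ ftplPolicy M X h (w (j, i)) x}
    ∪ {L}).Nonempty := ⟨L, by simp⟩
  constructor
  · intro hlt i hi hj
    have := Nat.sInf_le (s := {n : ℕ | ∃ i : Fin L, n = (i : ℕ) + 1 ∧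
      j ∈ ftplPolicy M X h (w (j, i)) x} ∪ {L}) (m := (i : ℕ) + 1) (Or.inl ⟨i, rfl, hj⟩)
    unfold resampleCount at hlt
    omega
  · intro hall
    by_contra hcon
    rcases Nat.sInf_mem hne with ⟨i, hi, hj⟩ | hL
    · refine hall i ?_ hj
      unfold resampleCount at hcon
      omega
    · have : resampleCount M X h w x j = L := hL
      omega

-- A layer-cake formula: f = 1 yields the count itself, and f k = 2k + 1 yields its square.
open Classical in
lemma sum_range_resampleCount (h : List (Outcome C K)) (w : Fin K × Fin L → FakeLosses X K)
    (x : C) (j : Fin K) (f : ℕ → ℝ) :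
    ∑ k ∈ Finset.range (resampleCount M X h w x j), f k = ∑ k ∈ Finset.range L,
      if ∀ i : Fin L, (i : ℕ) < k → j ∉ ftplPolicy M X h (w (j, i)) x then f k else 0 := by
  rw [← sum_range_ite_lt (resampleCount_le h w x j)]
  refine Finset.sum_congr rfl fun k hk => ?_
  simp only [lt_resampleCount_iff h w x j (Finset.mem_range.1 hk)]

lemma IsOracle.measurable_resampleCount (hM : IsOracle P M) {S : Type*} {_ : MeasurableSpace S}
    {h : S → List (Outcome C K)} (hh : ∀ p ∈ P, Measurable fun s => cumLoss p (h s))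
    {w : S → Fin K × Fin L → FakeLosses X K} (hw : Measurable w) {x : S → C}
    (hx : ∀ p ∈ P, ∀ j, MeasurableSet {s | j ∈ p (x s)}) (j : Fin K) :
    Measurable fun s => (resampleCount M X (h s) (w s) (x s) j : ℝ) := by
  classical
  have h1 : ∀ s, (resampleCount M X (h s) (w s) (x s) j : ℝ) = ∑ k ∈ Finset.range L,
      if ∀ i : Fin L, (i : ℕ) < k → j ∉ ftplPolicy M X (h s) (w s (j, i)) (x s) then (1 : ℝ)
        else 0 := by
    intro s
    rw [← sum_range_resampleCount]
    simp
  simp only [h1]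
  refine Finset.measurable_sum _ fun k _ => Measurable.ite ?_ measurable_const measurable_const
  simp only [Set.ofPred_forall]
  refine MeasurableSet.iInter fun i => MeasurableSet.iInter fun _ => ?_
  exact (hM.measurableSet_ftplPolicy hh (by fun_prop : Measurable fun s => w s (j, i))
    (fun s p => j ∈ p (x s)) fun p hp => hx p hp j).compl

/-- The law of the noise that is used for resampling. -/
noncomputable abbrev resampleLaw {C : Type*} (X : Finset C) (K L : ℕ) (ε : ℝ) :
    Measure (Fin K × Fin L → FakeLosses X K) := Measure.pi fun _ => fakeLaw X K ε

lemma selProb_nonneg (ε : ℝ) (h : List (Outcome C K)) (x : C) (j : Fin K) :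
    0 ≤ selProb M X ε h x j := measureReal_nonneg

lemma selProb_le_one {ε : ℝ} (hε : 0 < ε) (h : List (Outcome C K)) (x : C) (j : Fin K) :
    selProb M X ε h x j ≤ 1 := by
  have := isProbabilityMeasure_fakeLaw X K hε
  exact measureReal_le_one

/-- The event is a box that constrains exactly the k coordinates (j, 0), …, (j, k - 1) of a product
measure. -/
lemma IsOracle.measureReal_lt_resampleCount (hM : IsOracle P M) {ε : ℝ} (hε : 0 < ε)
    (h : List (Outcome C K)) (x : C) (j : Fin K) {k : ℕ} (hk : k < L) :
    (resampleLaw X K L ε).real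
      {w | ∀ i : Fin L, (i : ℕ) < k → j ∉ ftplPolicy M X h (w (j, i)) x}
      = (1 - selProb M X ε h x j) ^ k := by
  classical
  have := isProbabilityMeasure_fakeLaw X K hε
  set A : Set (FakeLosses X K) := {z | j ∈ ftplPolicy M X h z x} with hA
  have hAm : MeasurableSet A := hM.measurableSet_ftplPolicy_const h fun p => j ∈ p x
  set s : Fin K × Fin L → Set (FakeLosses X K) := fun i =>
    if i.1 = j ∧ (i.2 : ℕ) < k then Aᶜ else Set.univ with hs
  have h1 : {w : Fin K × Fin L → FakeLosses X K |
      ∀ i : Fin L, (i : ℕ) < k → j ∉ ftplPolicy M X h (w (j, i)) x} = Set.univ.pi s := by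
    ext w
    simp only [Set.mem_ofPred_eq, Set.mem_pi, Set.mem_univ, true_imp_iff, hs]
    constructor
    · rintro hw ⟨a, b⟩
      split_ifs with hi
      · obtain ⟨rfl, hb⟩ := hi
        exact hw b hb
      · trivial
    · intro hw i hi
      have := hw (j, i)
      simpa [hi, hA] using this
  rw [h1, measureReal_def, Measure.pi_pi, ENNReal.toReal_prod]
  have h2 : ∀ i, ((fakeLaw X K ε) (s i)).toReal
      = if i.1 = j ∧ (i.2 : ℕ) < k then 1 - selProb M X ε h x j else 1 := by
    intro i
    simp only [hs]
    split_ifs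
    · exact probReal_compl_eq_one_sub hAm
    · simp
  simp only [h2]
  rw [Fintype.prod_prod_type, Finset.prod_eq_single j]
  · simp only [true_and]
    rw [Finset.prod_ite, Finset.prod_const, Finset.prod_const_one, mul_one]
    congr 1
    have : (Finset.univ.filter fun i : Fin L => (i : ℕ) < k) = Finset.Iio ⟨k, hk⟩ := by
      ext i; simp [Fin.lt_def]
    rw [this, Fin.card_Iio]
  · intro i _ hi
    simp [hi]
  · simp

lemma IsOracle.integral_sum_range_resampleCount (hM : IsOracle P M) {ε : ℝ} (hε : 0 < ε)
    (h : List (Outcome C K)) (x : C) (j : Fin K) (f : ℕ → ℝ) :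
    ∫ w, ∑ k ∈ Finset.range (resampleCount M X h w x j), f k ∂(resampleLaw X K L ε)
      = ∑ k ∈ Finset.range L, f k * (1 - selProb M X ε h x j) ^ k := by
  classical
  have := isProbabilityMeasure_fakeLaw X K hε
  simp only [sum_range_resampleCount]
  have hm : ∀ k, MeasurableSet {w : Fin K × Fin L → FakeLosses X K |
      ∀ i : Fin L, (i : ℕ) < k → j ∉ ftplPolicy M X h (w (j, i)) x} := by
    intro k
    simp only [Set.ofPred_forall]
    refine MeasurableSet.iInter fun i => MeasurableSet.iInter fun _ => ?_
    exact (hM.measurableSet_ftplPolicy (h := fun _ => h) (fun _ _ => measurable_const)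
      (by fun_prop : Measurable fun w : Fin K × Fin L → FakeLosses X K => w (j, i))
      (fun _ p => j ∈ p x) fun p hp => MeasurableSet.const _).compl
  have h1 : ∀ (k : ℕ) (w : Fin K × Fin L → FakeLosses X K),
      (if ∀ i : Fin L, (i : ℕ) < k → j ∉ ftplPolicy M X h (w (j, i)) x then f k else 0)
        = {w : Fin K × Fin L → FakeLosses X K | ∀ i : Fin L, (i : ℕ) < k →
            j ∉ ftplPolicy M X h (w (j, i)) x}.indicator (fun _ => f k) w := fun k w => by
    simp [Set.indicator_apply]
  simp only [h1]
  rw [integral_finsetSum _ fun k _ => (integrable_const _).indicator (hm k)]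
  refine Finset.sum_congr rfl fun k hk => ?_
  rw [integral_indicator_const _ (hm k),
    hM.measureReal_lt_resampleCount hε h x j (Finset.mem_range.1 hk), smul_eq_mul, mul_comm]

lemma IsOracle.selProb_mul_integral_resampleCount (hM : IsOracle P M) {ε : ℝ} (hε : 0 < ε)
    (h : List (Outcome C K)) (x : C) (j : Fin K) :
    selProb M X ε h x j * ∫ w, (resampleCount M X h w x j : ℝ) ∂(resampleLaw X K L ε)
      = 1 - (1 - selProb M X ε h x j) ^ L := by
  have := hM.integral_sum_range_resampleCount (L := L) (X := X) hε h x j fun _ => 1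
  simp only [Finset.sum_const, Finset.card_range, nsmul_eq_mul, mul_one, one_mul] at this
  rw [this, mul_geom_sum_one_sub]

lemma IsOracle.selProb_sq_mul_integral_resampleCount_sq_le (hM : IsOracle P M) {ε : ℝ}
    (hε : 0 < ε) (h : List (Outcome C K)) (x : C) (j : Fin K) :
    selProb M X ε h x j ^ 2 * ∫ w, (resampleCount M X h w x j : ℝ) ^ 2 ∂(resampleLaw X K L ε)
      ≤ 2 := by
  have := hM.integral_sum_range_resampleCount (L := L) (X := X) hε h x j fun k => 2 * (k : ℝ) + 1
  simp only [sum_range_odd] at this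
  rw [this]
  exact sq_mul_sum_odd_mul_pow_le (selProb_nonneg _ _ _ _) (selProb_le_one hε _ _ _) L

lemma IsOracle.measurable_resampleCount_const (hM : IsOracle P M) (h : List (Outcome C K)) (x : C)
    (j : Fin K) : Measurable fun w : Fin K × Fin L → FakeLosses X K =>
      (resampleCount M X h w x j : ℝ) :=
  hM.measurable_resampleCount (h := fun _ => h) (x := fun _ => x) (fun _ _ => measurable_const)
    measurable_id (fun _ _ _ => MeasurableSet.const _) j

lemma IsOracle.integrable_resampleCount_mul (hM : IsOracle P M) {ε : ℝ} (hε : 0 < ε)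
    (h : List (Outcome C K)) (x : C) (i j : Fin K) :
    Integrable (fun w => (resampleCount M X h w x i : ℝ) * resampleCount M X h w x j)
      (resampleLaw X K L ε) := by
  have := isProbabilityMeasure_fakeLaw X K hε
  refine Integrable.of_bound ((hM.measurable_resampleCount_const h x i).mul
    (hM.measurable_resampleCount_const h x j)).aestronglyMeasurable ((L : ℝ) * L)
    (Filter.Eventually.of_forall fun w => ?_)
  rw [Real.norm_of_nonneg (by positivity)]
  gcongr <;> exact resampleCount_le _ _ _ _

/-- From 2ab ≤ a² + b² with a = q_i J(i) and b = q_j J(j), so that the diagonal and the off-diagonal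
pairs are treated alike, without using independence across coordinates. -/
lemma IsOracle.selProb_mul_integral_resampleCount_mul_le (hM : IsOracle P M) {ε : ℝ}
    (hε : 0 < ε) (h : List (Outcome C K)) (x : C) (i j : Fin K) :
    selProb M X ε h x i * selProb M X ε h x j *
      ∫ w, (resampleCount M X h w x i : ℝ) * resampleCount M X h w x j ∂(resampleLaw X K L ε)
      ≤ 2 := by
  have hi := hM.selProb_sq_mul_integral_resampleCount_sq_le (L := L) (X := X) hε h x i
  have hj := hM.selProb_sq_mul_integral_resampleCount_sq_le (L := L) (X := X) hε h x j
  have hii := hM.integrable_resampleCount_mul (L := L) (X := X) hε h x i i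
  have hjj := hM.integrable_resampleCount_mul (L := L) (X := X) hε h x j j
  simp only [← sq] at hii hjj
  have := integral_mono ((hM.integrable_resampleCount_mul (L := L) (X := X) hε h x i j).const_mul
      (2 * (selProb M X ε h x i * selProb M X ε h x j)))
    ((hii.const_mul (selProb M X ε h x i ^ 2)).add (hjj.const_mul (selProb M X ε h x j ^ 2)))
    (fun w => by
      simp only [Pi.add_apply]
      nlinarith [sq_nonneg (selProb M X ε h x i * (resampleCount M X h w x i : ℝ)
        - selProb M X ε h x j * (resampleCount M X h w x j : ℝ))])
  simp only [Pi.add_apply] at this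
  rw [integral_add (hii.const_mul _) (hjj.const_mul _), integral_const_mul, integral_const_mul,
    integral_const_mul] at this
  linarith

end Resample

/-! ### The norm of the selectable coordinates -/

section SelNorm

variable {C : Type*} {K : ℕ} {P : Finset (Policy C K)}

lemma selNorm_nonneg (P : Finset (Policy C K)) (l : Fin K → ℝ) : 0 ≤ selNorm P l :=
  Real.iSup_nonneg fun _ => abs_nonneg _

lemma le_selNorm {p : Policy C K} (hp : p ∈ P) {x : C} {j : Fin K} (hj : j ∈ p x)
    (l : Fin K → ℝ) : l j ≤ selNorm P l :=
  (le_abs_self _).trans (le_ciSup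
    (f := fun j : {j : Fin K // ∃ p ∈ P, ∃ x, j ∈ p x} => |l j|)
    (Set.finite_range _).bddAbove ⟨j, p, hp, x, hj⟩)

end SelNorm

/-! ### The loss estimates of a single round -/

section Round

variable {C : Type*} {K L : ℕ} {P : Finset (Policy C K)} {M : List (Outcome C K) → Policy C K}
  {X : Finset C}

/-- The loss estimate of a round with noise `ξ`. -/
noncomputable def roundEstimate (M : List (Outcome C K) → Policy C K) (X : Finset C)
    (h : List (Outcome C K)) (x : C) (l : Fin K → ℝ) (ξ : RoundNoise X K L) : Fin K → ℝ :=
  lossEstimate M X h ξ.2 x (ftplPolicy M X h ξ.1 x) fun j => l j.1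

lemma roundEstimate_apply (h : List (Outcome C K)) (x : C) (l : Fin K → ℝ)
    (ξ : RoundNoise X K L) (j : Fin K) :
    roundEstimate M X h x l ξ j
      = if j ∈ ftplPolicy M X h ξ.1 x then (resampleCount M X h ξ.2 x j : ℝ) * l j else 0 := by
  simp [roundEstimate, lossEstimate]

lemma roundEstimate_nonneg (h : List (Outcome C K)) (x : C) {l : Fin K → ℝ} (hl : ∀ j, 0 ≤ l j)
    (ξ : RoundNoise X K L) (j : Fin K) : 0 ≤ roundEstimate M X h x l ξ j := by
  rw [roundEstimate_apply]
  split_ifs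
  · exact mul_nonneg (Nat.cast_nonneg _) (hl j)
  · exact le_rfl

lemma IsOracle.roundEstimate_le (hM : IsOracle P M) (h : List (Outcome C K)) (x : C)
    {l : Fin K → ℝ} (hl : ∀ j, 0 ≤ l j) (ξ : RoundNoise X K L) (j : Fin K) :
    roundEstimate M X h x l ξ j ≤ L * selNorm P l := by
  rw [roundEstimate_apply]
  split_ifs with hj
  · refine mul_le_mul ?_ (le_selNorm (hM.mem _) hj l) (hl j) (Nat.cast_nonneg _)
    exact Nat.cast_le.2 (resampleCount_le _ _ _ _)
  · exact mul_nonneg (Nat.cast_nonneg _) (selNorm_nonneg _ _)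

lemma IsOracle.sum_roundEstimate_le (hM : IsOracle P M) (h : List (Outcome C K)) (x : C)
    {l : Fin K → ℝ} (hl : ∀ j, 0 ≤ l j) (ξ : RoundNoise X K L) :
    ∑ j, roundEstimate M X h x l ξ j ≤ K * (L * selNorm P l) := by
  refine (Finset.sum_le_sum fun j _ => hM.roundEstimate_le h x hl ξ j).trans ?_
  simp

lemma IsOracle.measurable_roundEstimate (hM : IsOracle P M) {S : Type*} {_ : MeasurableSpace S}
    {h : S → List (Outcome C K)} (hh : ∀ p ∈ P, Measurable fun s => cumLoss p (h s))
    {x : S → C} (hx : ∀ p ∈ P, ∀ j, MeasurableSet {s | j ∈ p (x s)})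
    {l : S → Fin K → ℝ} (hl : Measurable l) {ξ : S → RoundNoise X K L} (hξ : Measurable ξ)
    (j : Fin K) : Measurable fun s => roundEstimate M X (h s) (x s) (l s) (ξ s) j := by
  simp only [roundEstimate_apply]
  refine Measurable.ite ?_ ?_ measurable_const
  · exact hM.measurableSet_ftplPolicy hh (hξ.fst) (fun s p => j ∈ p (x s)) fun p hp => hx p hp j
  · exact (hM.measurable_resampleCount hh hξ.snd hx j).mul (by fun_prop)

/-- The probability is the mass of a section of a measurable set in the product of the past and the
noise. -/
lemma IsOracle.measurable_selProb (hM : IsOracle P M) {S : Type*} {_ : MeasurableSpace S}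
    {h : S → List (Outcome C K)} (hh : ∀ p ∈ P, Measurable fun s => cumLoss p (h s))
    {x : S → C} (hx : ∀ p ∈ P, ∀ j, MeasurableSet {s | j ∈ p (x s)}) {ε : ℝ} (hε : 0 < ε)
    (j : Fin K) : Measurable fun s => selProb M X ε (h s) (x s) j := by
  have := isProbabilityMeasure_fakeLaw X K hε
  have hm : MeasurableSet {y : S × FakeLosses X K | j ∈ ftplPolicy M X (h y.1) y.2 (x y.1)} :=
    hM.measurableSet_ftplPolicy (S := S × FakeLosses X K) (h := fun y => h y.1)
      (fun p hp => (hh p hp).comp measurable_fst)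
      measurable_snd (fun y p => j ∈ p (x y.1)) fun p hp => (hx p hp j).preimage measurable_fst
  exact (measurable_measure_prodMk_left hm).ennreal_toReal

open Classical in
/-- The probability that the perturbed leader selects both `i` and `j` in the context `x`. -/
noncomputable def pairProb (M : List (Outcome C K) → Policy C K) (X : Finset C) (ε : ℝ)
    (h : List (Outcome C K)) (x : C) (i j : Fin K) : ℝ :=
  ∫ z, (if i ∈ ftplPolicy M X h z x then if j ∈ ftplPolicy M X h z x then (1 : ℝ) else 0 else 0)
    ∂(fakeLaw X K ε)

lemma pairProb_nonneg (ε : ℝ) (h : List (Outcome C K)) (x : C) (i j : Fin K) :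
    0 ≤ pairProb M X ε h x i j := by
  refine integral_nonneg fun z => ?_
  simp only [Pi.zero_apply]
  split_ifs <;> norm_num

lemma IsOracle.integral_ite_mem (hM : IsOracle P M) (h : List (Outcome C K)) (x : C) {ε : ℝ}
    (i : Fin K) (a : ℝ) :
    ∫ z, (if i ∈ ftplPolicy M X h z x then a else 0) ∂(fakeLaw X K ε)
      = selProb M X ε h x i * a := by
  have h1 : ∀ z : FakeLosses X K, (if i ∈ ftplPolicy M X h z x then a else 0)
      = {z | i ∈ ftplPolicy M X h z x}.indicator (fun _ => a) z := fun z => by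
    simp [Set.indicator_apply]
  simp only [h1]
  rw [integral_indicator_const _ (hM.measurableSet_ftplPolicy_const h fun p => i ∈ p x)]
  rfl

lemma IsOracle.pairProb_self (hM : IsOracle P M) {ε : ℝ} (h : List (Outcome C K)) (x : C)
    (i : Fin K) : pairProb M X ε h x i i = selProb M X ε h x i := by
  rw [← mul_one (selProb M X ε h x i), ← hM.integral_ite_mem h x i 1]
  refine integral_congr_ae (Filter.Eventually.of_forall fun z => ?_)
  simp only
  split_ifs <;> rfl

lemma IsOracle.sum_pairProb_le (hM : IsOracle P M) {m : ℕ} (hm : ∀ p ∈ P, ∀ x, (p x).card ≤ m)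
    {ε : ℝ} (hε : 0 < ε) (h : List (Outcome C K)) (x : C) (i : Fin K) :
    ∑ j, pairProb M X ε h x i j ≤ m * selProb M X ε h x i := by
  classical
  have := isProbabilityMeasure_fakeLaw X K hε
  unfold pairProb
  rw [← integral_finsetSum _ fun j _ => hM.integrable_ftplPolicy_comp h
      (fun p => if i ∈ p x then if j ∈ p x then (1 : ℝ) else 0 else 0) hε,
    mul_comm, ← hM.integral_ite_mem h x i]
  refine integral_mono (integrable_finsetSum _ fun j _ => hM.integrable_ftplPolicy_comp h
      (fun p => if i ∈ p x then if j ∈ p x then (1 : ℝ) else 0 else 0) hε)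
    (hM.integrable_ftplPolicy_comp h (fun p => if i ∈ p x then (m : ℝ) else 0) hε) fun z => ?_
  simp only
  split_ifs with hi
  · simpa using hm (ftplPolicy M X h z) (hM.mem _) x
  · simp

/-- Needed where q_i is cancelled from an inequality. The row sum is bounded through the trivial
action size K. -/
lemma IsOracle.pairProb_eq_zero (hM : IsOracle P M) {ε : ℝ} (hε : 0 < ε)
    {h : List (Outcome C K)} {x : C} {i : Fin K} (hi : selProb M X ε h x i = 0) (j : Fin K) :
    pairProb M X ε h x i j = 0 := by
  have h1 : ∑ j, pairProb M X ε h x i j ≤ 0 := by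
    simpa [hi] using hM.sum_pairProb_le (X := X) (m := K)
      (fun p _ x => (Finset.card_le_univ _).trans (by simp)) hε h x i
  exact le_antisymm ((Finset.single_le_sum (f := fun j => pairProb M X ε h x i j)
    (fun j _ => pairProb_nonneg _ _ _ _ _) (Finset.mem_univ j)).trans h1) (pairProb_nonneg _ _ _ _ _)

/-- If `i` and `j` are selected simultaneously with positive probability, then they are
selectable. -/
lemma IsOracle.pairProb_mul_le (hM : IsOracle P M) {ε : ℝ} (h : List (Outcome C K)) (x : C)
    {l : Fin K → ℝ} (hl : ∀ j, 0 ≤ l j) (i j : Fin K) :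
    pairProb M X ε h x i j * (l i * l j) ≤ pairProb M X ε h x i j * selNorm P l ^ 2 := by
  by_cases hz : ∃ z : FakeLosses X K, i ∈ ftplPolicy M X h z x ∧ j ∈ ftplPolicy M X h z x
  · obtain ⟨z, hi, hj⟩ := hz
    rw [sq]
    exact mul_le_mul_of_nonneg_left (mul_le_mul (le_selNorm (hM.mem _) hi l)
      (le_selNorm (hM.mem _) hj l) (hl j) (selNorm_nonneg _ _)) (pairProb_nonneg _ _ _ _ _)
  · have : pairProb M X ε h x i j = 0 := by
      unfold pairProb
      refine integral_eq_zero_of_ae (Filter.Eventually.of_forall fun z => ?_)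
      simp only [Pi.zero_apply]
      split_ifs with hi hj
      · exact absurd ⟨z, hi, hj⟩ hz
      · rfl
      · rfl
    simp [this]

lemma IsOracle.measurable_roundEstimate_const (hM : IsOracle P M) (h : List (Outcome C K)) (x : C)
    (l : Fin K → ℝ) (j : Fin K) :
    Measurable fun ξ : RoundNoise X K L => roundEstimate M X h x l ξ j :=
  hM.measurable_roundEstimate (h := fun _ => h) (x := fun _ => x) (l := fun _ => l)
    (fun _ _ => measurable_const) (fun _ _ _ => MeasurableSet.const _) measurable_const
    measurable_id j

lemma IsOracle.integrable_roundEstimate (hM : IsOracle P M) {ε : ℝ} (hε : 0 < ε)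
    (h : List (Outcome C K)) (x : C) {l : Fin K → ℝ} (hl : ∀ j, 0 ≤ l j) (j : Fin K) :
    Integrable (fun ξ => roundEstimate M X h x l ξ j) (roundLaw X K L ε) := by
  have := isProbabilityMeasure_roundLaw X K L hε
  refine Integrable.of_bound (hM.measurable_roundEstimate_const h x l j).aestronglyMeasurable
    (L * selNorm P l) (Filter.Eventually.of_forall fun ξ => ?_)
  rw [Real.norm_of_nonneg (roundEstimate_nonneg h x hl ξ j)]
  exact hM.roundEstimate_le h x hl ξ j

lemma IsOracle.integrable_roundEstimate_mul (hM : IsOracle P M) {ε : ℝ} (hε : 0 < ε)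
    (h : List (Outcome C K)) (x : C) {l : Fin K → ℝ} (hl : ∀ j, 0 ≤ l j) (i j : Fin K) :
    Integrable (fun ξ => roundEstimate M X h x l ξ i * roundEstimate M X h x l ξ j)
      (roundLaw X K L ε) := by
  have := isProbabilityMeasure_roundLaw X K L hε
  refine Integrable.of_bound ((hM.measurable_roundEstimate_const h x l i).mul
    (hM.measurable_roundEstimate_const h x l j)).aestronglyMeasurable
    (L * selNorm P l * (L * selNorm P l)) (Filter.Eventually.of_forall fun ξ => ?_)
  have hi := roundEstimate_nonneg (M := M) h x hl ξ i
  have hj := roundEstimate_nonneg (M := M) h x hl ξ j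
  rw [Real.norm_of_nonneg (mul_nonneg hi hj)]
  exact mul_le_mul (hM.roundEstimate_le h x hl ξ i) (hM.roundEstimate_le h x hl ξ j) hj
    (hi.trans (hM.roundEstimate_le h x hl ξ i))

/-- The bias of the loss estimate. -/
lemma IsOracle.integral_roundEstimate (hM : IsOracle P M) {ε : ℝ} (hε : 0 < ε)
    (h : List (Outcome C K)) (x : C) (l : Fin K → ℝ) (j : Fin K) :
    ∫ ξ, roundEstimate M X h x l ξ j ∂(roundLaw X K L ε)
      = (1 - (1 - selProb M X ε h x j) ^ L) * l j := by
  classical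
  have := isProbabilityMeasure_fakeLaw X K hε
  have h1 : ∀ ξ : RoundNoise X K L, roundEstimate M X h x l ξ j
      = (if j ∈ ftplPolicy M X h ξ.1 x then l j else 0) * (resampleCount M X h ξ.2 x j : ℝ) := by
    intro ξ
    rw [roundEstimate_apply]
    split_ifs <;> ring
  simp only [h1]
  unfold roundLaw
  rw [integral_prod_mul (f := fun z => if j ∈ ftplPolicy M X h z x then l j else 0)
    (g := fun w => (resampleCount M X h w x j : ℝ)), hM.integral_ite_mem,
    ← hM.selProb_mul_integral_resampleCount hε h x j]
  ring

/-- The action and the counts use independent parts of the noise, so the integral factorizes. -/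
lemma integral_roundEstimate_mul {ε : ℝ} (hε : 0 < ε)
    (h : List (Outcome C K)) (x : C) (l : Fin K → ℝ) (i j : Fin K) :
    ∫ ξ, roundEstimate M X h x l ξ i * roundEstimate M X h x l ξ j ∂(roundLaw X K L ε)
      = pairProb M X ε h x i j * (l i * l j) *
        ∫ w, (resampleCount M X h w x i : ℝ) * resampleCount M X h w x j
          ∂(resampleLaw X K L ε) := by
  classical
  have := isProbabilityMeasure_fakeLaw X K hε
  have h1 : ∀ ξ : RoundNoise X K L, roundEstimate M X h x l ξ i * roundEstimate M X h x l ξ j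
      = l i * l j * ((if i ∈ ftplPolicy M X h ξ.1 x then
          if j ∈ ftplPolicy M X h ξ.1 x then (1 : ℝ) else 0 else 0)
        * ((resampleCount M X h ξ.2 x i : ℝ) * resampleCount M X h ξ.2 x j)) := by
    intro ξ
    rw [roundEstimate_apply, roundEstimate_apply]
    split_ifs <;> ring
  simp only [h1]
  unfold roundLaw
  rw [integral_const_mul, integral_prod_mul (f := fun z => if i ∈ ftplPolicy M X h z x then
        if j ∈ ftplPolicy M X h z x then (1 : ℝ) else 0 else 0)
    (g := fun w => (resampleCount M X h w x i : ℝ) * resampleCount M X h w x j)]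
  unfold pairProb
  ring

/-- The second moment that controls the stability term in the transductive setting. -/
lemma IsOracle.integral_sum_mul_sum_le (hM : IsOracle P M) {m : ℕ}
    (hm : ∀ p ∈ P, ∀ x, (p x).card ≤ m) {ε : ℝ} (hε : 0 < ε)
    (h : List (Outcome C K)) (x : C) {l : Fin K → ℝ} (hl : ∀ j, 0 ≤ l j) :
    ∫ ξ, (∑ i, roundEstimate M X h x l ξ i)
        * (∑ j, selProb M X ε h x j * roundEstimate M X h x l ξ j) ∂(roundLaw X K L ε)
      ≤ 2 * m * K * selNorm P l ^ 2 := by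
  have h1 : ∀ ξ : RoundNoise X K L, (∑ i, roundEstimate M X h x l ξ i)
        * (∑ j, selProb M X ε h x j * roundEstimate M X h x l ξ j)
      = ∑ i, ∑ j, selProb M X ε h x j *
        (roundEstimate M X h x l ξ i * roundEstimate M X h x l ξ j) := by
    intro ξ
    rw [Finset.sum_mul_sum]
    exact Finset.sum_congr rfl fun i _ => Finset.sum_congr rfl fun j _ => by ring
  simp only [h1]
  rw [integral_finsetSum _ fun i _ => integrable_finsetSum _ fun j _ =>
    (hM.integrable_roundEstimate_mul hε h x hl i j).const_mul _]
  have h2 : ∀ i, ∫ ξ, ∑ j, selProb M X ε h x j *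
      (roundEstimate M X h x l ξ i * roundEstimate M X h x l ξ j) ∂(roundLaw X K L ε)
      ≤ 2 * m * selNorm P l ^ 2 := by
    intro i
    rw [integral_finsetSum _ fun j _ => (hM.integrable_roundEstimate_mul hε h x hl i j).const_mul _]
    simp only [integral_const_mul, integral_roundEstimate_mul hε h x l i]
    rcases (selProb_nonneg (M := M) (X := X) ε h x i).eq_or_lt with hq | hq
    · simp only [hM.pairProb_eq_zero hε hq.symm, zero_mul, mul_zero, Finset.sum_const_zero]
      positivity
    -- After multiplication by q_i, each term contains q_i q_j E[J(i) J(j)] ≤ 2. The remaining pair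
    -- probabilities sum over j to at most m q_i, and q_i cancels.
    · refine le_of_mul_le_mul_left ?_ hq
      rw [Finset.mul_sum]
      calc _ ≤ ∑ j, 2 * selNorm P l ^ 2 * pairProb M X ε h x i j := by
            refine Finset.sum_le_sum fun j _ => ?_
            have hE := hM.selProb_mul_integral_resampleCount_mul_le (L := L) (X := X) hε h x i j
            have hR := hM.pairProb_mul_le (X := X) (ε := ε) h x hl i j
            have hR0 : 0 ≤ pairProb M X ε h x i j * (l i * l j) :=
              mul_nonneg (pairProb_nonneg _ _ _ _ _) (mul_nonneg (hl i) (hl j))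
            have := mul_le_mul_of_nonneg_left hE hR0
            linarith
        _ ≤ 2 * selNorm P l ^ 2 * (m * selProb M X ε h x i) := by
            rw [← Finset.mul_sum]
            exact mul_le_mul_of_nonneg_left (hM.sum_pairProb_le hm hε h x i) (by positivity)
        _ = _ := by ring
  refine (Finset.sum_le_sum fun i _ => h2 i).trans (le_of_eq ?_)
  simp only [Finset.sum_const, Finset.card_univ, Fintype.card_fin, nsmul_eq_mul]
  ring

/-- The second moment that controls the stability term in the small separator setting. -/
lemma IsOracle.integral_sq_sum_le (hM : IsOracle P M) {m : ℕ}
    (hm : ∀ p ∈ P, ∀ x, (p x).card ≤ m) {ε : ℝ} (hε : 0 < ε)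
    (h : List (Outcome C K)) (x : C) {l : Fin K → ℝ} (hl : ∀ j, 0 ≤ l j) :
    ∫ ξ, (∑ i, roundEstimate M X h x l ξ i) ^ 2 ∂(roundLaw X K L ε)
      ≤ m * K * L * selNorm P l ^ 2 := by
  have := isProbabilityMeasure_fakeLaw X K hε
  -- Cauchy–Schwarz on the support of the estimate, which is contained in the action played and has
  -- at most m elements.
  have h1 : ∀ ξ : RoundNoise X K L, (∑ i, roundEstimate M X h x l ξ i) ^ 2
      ≤ m * ∑ i, roundEstimate M X h x l ξ i * roundEstimate M X h x l ξ i := by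
    intro ξ
    have hs : ∀ f : Fin K → ℝ, (∀ i, i ∉ ftplPolicy M X h ξ.1 x → f i = 0) →
        ∑ i, f i = ∑ i ∈ ftplPolicy M X h ξ.1 x, f i := fun f hf =>
      (Finset.sum_subset (Finset.subset_univ _) fun i _ hi => hf i hi).symm
    have h0 : ∀ i, i ∉ ftplPolicy M X h ξ.1 x → roundEstimate M X h x l ξ i = 0 := fun i hi => by
      rw [roundEstimate_apply, if_neg hi]
    rw [hs _ h0, hs _ fun i hi => by rw [h0 i hi, zero_mul]]
    simp only [← sq]
    refine sq_sum_le_card_mul_sum_sq.trans ?_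
    refine mul_le_mul_of_nonneg_right ?_ (Finset.sum_nonneg fun _ _ => sq_nonneg _)
    exact_mod_cast hm _ (hM.mem _) x
  have h2 : ∀ i, ∫ ξ, roundEstimate M X h x l ξ i * roundEstimate M X h x l ξ i
      ∂(roundLaw X K L ε) ≤ L * selNorm P l ^ 2 := by
    intro i
    rw [integral_roundEstimate_mul hε h x l i i]
    have hR := hM.pairProb_mul_le (X := X) (ε := ε) h x hl i i
    rw [hM.pairProb_self] at hR ⊢
    -- Here only one factor q_i is available. Truncation gives J² ≤ L J, and q_i E J ≤ 1 absorbs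
    -- that factor.
    have hJ : ∫ w, (resampleCount M X h w x i : ℝ) * resampleCount M X h w x i
        ∂(resampleLaw X K L ε)
        ≤ L * ∫ w, (resampleCount M X h w x i : ℝ) ∂(resampleLaw X K L ε) := by
      rw [← integral_const_mul]
      have hi : Integrable (fun w => (resampleCount M X h w x i : ℝ)) (resampleLaw X K L ε) :=
        Integrable.of_bound (hM.measurable_resampleCount_const h x i).aestronglyMeasurable
          (L : ℝ) (Filter.Eventually.of_forall fun w => by
            rw [Real.norm_of_nonneg (Nat.cast_nonneg _)]
            exact Nat.cast_le.2 (resampleCount_le _ _ _ _))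
      refine integral_mono (hM.integrable_resampleCount_mul hε h x i i) (hi.const_mul _)
        fun w => ?_
      refine mul_le_mul_of_nonneg_right ?_ (Nat.cast_nonneg _)
      exact Nat.cast_le.2 (resampleCount_le _ _ _ _)
    set I := ∫ w, (resampleCount M X h w x i : ℝ) ∂(resampleLaw X K L ε) with hI
    have hI0 : 0 ≤ I := integral_nonneg fun _ => Nat.cast_nonneg _
    have hqI : selProb M X ε h x i * I ≤ 1 := by
      rw [hM.selProb_mul_integral_resampleCount hε h x i]
      have := pow_nonneg (sub_nonneg.2 (selProb_le_one (M := M) (X := X) hε h x i)) L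
      linarith
    have hq := selProb_nonneg (M := M) (X := X) ε h x i
    have hR0 : 0 ≤ selProb M X ε h x i * (l i * l i) :=
      mul_nonneg hq (mul_nonneg (hl i) (hl i))
    calc _ ≤ selProb M X ε h x i * (l i * l i) * (L * I) := mul_le_mul_of_nonneg_left hJ hR0
      _ ≤ selProb M X ε h x i * selNorm P l ^ 2 * (L * I) :=
          mul_le_mul_of_nonneg_right hR (mul_nonneg (Nat.cast_nonneg _) hI0)
      _ = L * selNorm P l ^ 2 * (selProb M X ε h x i * I) := by ring
      _ ≤ L * selNorm P l ^ 2 * 1 := mul_le_mul_of_nonneg_left hqI (by positivity)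
      _ = _ := mul_one _
  have hint : ∀ i ∈ Finset.univ, Integrable (fun ξ => roundEstimate M X h x l ξ i *
      roundEstimate M X h x l ξ i) (roundLaw X K L ε) := fun i _ =>
    hM.integrable_roundEstimate_mul hε h x hl i i
  refine (integral_mono_of_nonneg (Filter.Eventually.of_forall fun ξ => sq_nonneg _)
    ((integrable_finsetSum _ hint).const_mul (m : ℝ))
    (Filter.Eventually.of_forall h1)).trans ?_
  rw [integral_const_mul, integral_finsetSum _ hint]
  refine (mul_le_mul_of_nonneg_left (Finset.sum_le_sum fun i _ => h2 i)
    (Nat.cast_nonneg m)).trans (le_of_eq ?_)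
  simp only [Finset.sum_const, Finset.card_univ, Fintype.card_fin, nsmul_eq_mul]
  ring

end Round

/-! ### A round against an adversary -/

/-- The substitute for conditioning on the past: by independence the joint law is a product, and
Fubini integrates the fresh noise first. -/
lemma integral_comp_of_indepFun {Ω S E : Type*} {_ : MeasurableSpace Ω} {_ : MeasurableSpace S}
    {_ : MeasurableSpace E} {μ : Measure Ω} [IsProbabilityMeasure μ] {ρ : Measure E} {g : Ω → S}
    {ξ : Ω → E} (hg : Measurable g) (hξ : Measurable ξ) (hind : IndepFun g ξ μ)
    (hρ : μ.map ξ = ρ) {F : S × E → ℝ} (hF : Measurable F)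
    (hI : Integrable (fun ω => F (g ω, ξ ω)) μ) :
    Integrable (fun ω => ∫ e, F (g ω, e) ∂ρ) μ ∧
      ∫ ω, F (g ω, ξ ω) ∂μ = ∫ ω, ∫ e, F (g ω, e) ∂ρ ∂μ := by
  have hρp : IsProbabilityMeasure ρ := hρ ▸ Measure.isProbabilityMeasure_map hξ.aemeasurable
  have hgp : IsProbabilityMeasure (μ.map g) := Measure.isProbabilityMeasure_map hg.aemeasurable
  have hmap : μ.map (fun ω => (g ω, ξ ω)) = (μ.map g).prod ρ := by
    rw [← hρ]
    exact (indepFun_iff_map_prod_eq_prod_map_map hg.aemeasurable hξ.aemeasurable).1 hind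
  have hIp : Integrable F ((μ.map g).prod ρ) := by
    rw [← hmap, integrable_map_measure hF.aestronglyMeasurable (by fun_prop)]
    exact hI
  have hI2 := hIp.integral_prod_left
  constructor
  · exact (integrable_map_measure hI2.aestronglyMeasurable hg.aemeasurable).1 hI2
  · rw [← integral_map (φ := fun ω => (g ω, ξ ω)) (by fun_prop) hF.aestronglyMeasurable, hmap,
      integral_prod _ hIp,
      integral_map hg.aemeasurable hI2.aestronglyMeasurable]

/-- A round in which the history `h`, the context `x` and the loss `l` depend on the past `g` and
the noise `ξ` of the learner is independent of the past. -/
structure IsRound {Ω S C : Type*} {mΩ : MeasurableSpace Ω} (mS : MeasurableSpace S) {K L : ℕ}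
    (P : Finset (Policy C K)) (M : List (Outcome C K) → Policy C K) (X : Finset C) (ε : ℝ)
    (μ : Measure Ω) (h : S → List (Outcome C K)) (x : S → C) (l : S → Fin K → ℝ) (g : Ω → S)
    (ξ : Ω → RoundNoise X K L) : Prop where
  isOracle : IsOracle P M
  eps_pos : 0 < ε
  hist_measurable : ∀ p ∈ P, Measurable fun s => cumLoss p (h s)
  context_measurable : ∀ p ∈ P, ∀ j, MeasurableSet {s | j ∈ p (x s)}
  loss_measurable : Measurable l
  loss_nonneg : ∀ s j, 0 ≤ l s j
  past_measurable : Measurable g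
  noise_measurable : Measurable ξ
  indep : IndepFun g ξ μ
  noise_law : μ.map ξ = roundLaw X K L ε
  sq_integrable : Integrable (fun ω => selNorm P (l (g ω)) ^ 2) μ

section Basic

variable {C : Type*} {K L : ℕ} {P : Finset (Policy C K)} {M : List (Outcome C K) → Policy C K}
  {X : Finset C}

lemma actionLoss_le_selNorm {p : Policy C K} (hp : p ∈ P) (x : C) (l : Fin K → ℝ) :
    actionLoss (p x) l ≤ K * selNorm P l := by
  refine (Finset.sum_le_card_nsmul _ _ _ fun j hj => le_selNorm hp hj l).trans ?_
  rw [nsmul_eq_mul]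
  refine mul_le_mul_of_nonneg_right ?_ (selNorm_nonneg _ _)
  exact_mod_cast (Finset.card_le_univ (p x)).trans (by simp)

lemma IsOracle.selProb_mul_le (hM : IsOracle P M) {ε : ℝ} (h : List (Outcome C K)) (x : C)
    (l : Fin K → ℝ) (j : Fin K) :
    selProb M X ε h x j * l j ≤ selProb M X ε h x j * selNorm P l := by
  by_cases hz : ∃ z : FakeLosses X K, j ∈ ftplPolicy M X h z x
  · obtain ⟨z, hj⟩ := hz
    exact mul_le_mul_of_nonneg_left (le_selNorm (hM.mem _) hj l) (selProb_nonneg _ _ _ _)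
  · have : selProb M X ε h x j = 0 := by
      have he : {z : FakeLosses X K | j ∈ ftplPolicy M X h z x} = ∅ :=
        Set.eq_empty_iff_forall_notMem.2 fun z hz' => hz ⟨z, hz'⟩
      unfold selProb
      rw [he, measureReal_empty]
    simp [this]

lemma sum_selProb_mul_roundEstimate_le {ε : ℝ} (hε : 0 < ε)
    (h : List (Outcome C K)) (x : C) {l : Fin K → ℝ} (hl : ∀ j, 0 ≤ l j) (ξ : RoundNoise X K L) :
    ∑ j, selProb M X ε h x j * roundEstimate M X h x l ξ j ≤ ∑ j, roundEstimate M X h x l ξ j :=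
  Finset.sum_le_sum fun j _ => mul_le_of_le_one_left (roundEstimate_nonneg h x hl ξ j)
    (selProb_le_one hε h x j)

lemma sum_selProb_mul_roundEstimate_nonneg {ε : ℝ}
    (h : List (Outcome C K)) (x : C) {l : Fin K → ℝ} (hl : ∀ j, 0 ≤ l j) (ξ : RoundNoise X K L) :
    0 ≤ ∑ j, selProb M X ε h x j * roundEstimate M X h x l ξ j :=
  Finset.sum_nonneg fun j _ => mul_nonneg (selProb_nonneg ε h x j) (roundEstimate_nonneg h x hl ξ j)

/-- The conditional expectation of the regret with respect to `p` that is not accounted for by the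
estimated losses. -/
lemma IsOracle.integral_bias_le (hM : IsOracle P M) {ε : ℝ} (hε : 0 < ε) (hL : 1 ≤ L)
    (h : List (Outcome C K)) (x : C) {l : Fin K → ℝ} (hl : ∀ j, 0 ≤ l j) (p : Policy C K) :
    ∫ ξ : RoundNoise X K L, (actionLoss (ftplPolicy M X h ξ.1 x) l - actionLoss (p x) l
      - ((∑ j, selProb M X ε h x j * roundEstimate M X h x l ξ j)
        - actionLoss (p x) (roundEstimate M X h x l ξ))) ∂(roundLaw X K L ε)
      ≤ K / (Real.exp 1 * L) * selNorm P l := by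
  have := isProbabilityMeasure_fakeLaw X K hε
  have := isProbabilityMeasure_roundLaw X K L hε
  have hest := fun j => hM.integrable_roundEstimate (L := L) (X := X) hε h x hl j
  have h1 : Integrable (fun ξ : RoundNoise X K L => actionLoss (ftplPolicy M X h ξ.1 x) l)
      (roundLaw X K L ε) :=
    (hM.integrable_ftplPolicy_comp h (fun p => actionLoss (p x) l) hε).comp_fst _
  have h2 : Integrable (fun ξ : RoundNoise X K L =>
      ∑ j, selProb M X ε h x j * roundEstimate M X h x l ξ j) (roundLaw X K L ε) :=
    integrable_finsetSum _ fun j _ => (hest j).const_mul _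
  have h3 : Integrable (fun ξ : RoundNoise X K L => actionLoss (p x) (roundEstimate M X h x l ξ))
      (roundLaw X K L ε) := integrable_finsetSum _ fun j _ => hest j
  have e1 : ∫ ξ : RoundNoise X K L, actionLoss (ftplPolicy M X h ξ.1 x) l ∂(roundLaw X K L ε)
      = ∑ j, selProb M X ε h x j * l j := by
    unfold roundLaw
    rw [integral_fun_fst (f := fun z => actionLoss (ftplPolicy M X h z x) l),
      hM.integral_actionLoss_ftplPolicy h hε]
    simp
  have e2 : ∫ ξ : RoundNoise X K L, ∑ j, selProb M X ε h x j * roundEstimate M X h x l ξ j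
      ∂(roundLaw X K L ε)
      = ∑ j, selProb M X ε h x j * ((1 - (1 - selProb M X ε h x j) ^ L) * l j) := by
    rw [integral_finsetSum _ fun j _ => (hest j).const_mul _]
    simp only [integral_const_mul, hM.integral_roundEstimate hε]
  -- Underestimation acts in the right direction for the comparator, so no bias is paid here.
  have e3 : ∫ ξ : RoundNoise X K L, actionLoss (p x) (roundEstimate M X h x l ξ)
      ∂(roundLaw X K L ε) ≤ actionLoss (p x) l := by
    unfold actionLoss
    rw [integral_finsetSum _ fun j _ => hest j]
    refine Finset.sum_le_sum fun j _ => ?_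
    rw [hM.integral_roundEstimate hε]
    refine mul_le_of_le_one_left (hl j) ?_
    have := pow_nonneg (sub_nonneg.2 (selProb_le_one (M := M) (X := X) hε h x j)) L
    linarith
  have h4 : Integrable (fun ξ : RoundNoise X K L =>
      actionLoss (ftplPolicy M X h ξ.1 x) l - actionLoss (p x) l) (roundLaw X K L ε) :=
    h1.sub (integrable_const _)
  have h5 : Integrable (fun ξ : RoundNoise X K L =>
      (∑ j, selProb M X ε h x j * roundEstimate M X h x l ξ j)
        - actionLoss (p x) (roundEstimate M X h x l ξ)) (roundLaw X K L ε) := h2.sub h3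
  rw [integral_sub h4 h5, integral_sub h1 (integrable_const _), integral_sub h2 h3, e1, e2]
  simp only [integral_const, probReal_univ, smul_eq_mul, one_mul]
  have e4 : ∑ j, selProb M X ε h x j * l j
      - ∑ j, selProb M X ε h x j * ((1 - (1 - selProb M X ε h x j) ^ L) * l j)
      ≤ K / (Real.exp 1 * L) * selNorm P l := by
    rw [← Finset.sum_sub_distrib]
    have : ∀ j : Fin K, selProb M X ε h x j * l j
        - selProb M X ε h x j * ((1 - (1 - selProb M X ε h x j) ^ L) * l j)
        ≤ 1 / (Real.exp 1 * L) * selNorm P l := by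
      intro j
      have hq0 := selProb_nonneg (M := M) (X := X) ε h x j
      have hq1 := selProb_le_one (M := M) (X := X) hε h x j
      have hpow := pow_nonneg (sub_nonneg.2 hq1) L
      calc _ = (1 - selProb M X ε h x j) ^ L * (selProb M X ε h x j * l j) := by ring
        _ ≤ (1 - selProb M X ε h x j) ^ L * (selProb M X ε h x j * selNorm P l) :=
          mul_le_mul_of_nonneg_left (hM.selProb_mul_le h x l j) hpow
        _ = selProb M X ε h x j * (1 - selProb M X ε h x j) ^ L * selNorm P l := by ring
        _ ≤ _ := mul_le_mul_of_nonneg_right (mul_one_sub_pow_le hq0 hq1 hL) (selNorm_nonneg _ _)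
    refine (Finset.sum_le_sum fun j _ => this j).trans (le_of_eq ?_)
    simp only [Finset.sum_const, Finset.card_univ, Fintype.card_fin, nsmul_eq_mul]
    ring
  linarith

end Basic

/-! ### Integrability and expectations in one round with a random past. -/

namespace IsRound

variable {Ω S C : Type*} {mΩ : MeasurableSpace Ω} {mS : MeasurableSpace S} {K L : ℕ}
  {P : Finset (Policy C K)} {M : List (Outcome C K) → Policy C K} {X : Finset C} {ε : ℝ}
  {μ : Measure Ω} {h : S → List (Outcome C K)} {x : S → C} {l : S → Fin K → ℝ} {g : Ω → S}
  {ξ : Ω → RoundNoise X K L}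

lemma norm_integrable [IsProbabilityMeasure μ] (H : IsRound mS P M X ε μ h x l g ξ) :
    Integrable (fun ω => selNorm P (l (g ω))) μ := by
  -- Measurability is inherited from the square through the root; integrability then follows from s
  -- ≤ s² + 1.
  have h1 : (fun ω => selNorm P (l (g ω))) = fun ω => √(selNorm P (l (g ω)) ^ 2) := by
    funext ω
    rw [Real.sqrt_sq (selNorm_nonneg _ _)]
  refine (H.sq_integrable.add (integrable_const 1)).mono' ?_
    (Filter.Eventually.of_forall fun ω => ?_)
  · rw [h1]
    exact Real.continuous_sqrt.comp_aestronglyMeasurable H.sq_integrable.aestronglyMeasurable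
  · rw [Real.norm_of_nonneg (selNorm_nonneg _ _)]
    simp only [Pi.add_apply]
    nlinarith [sq_nonneg (selNorm P (l (g ω)) - 1), selNorm_nonneg P (l (g ω))]

lemma measurable_estimate (H : IsRound mS P M X ε μ h x l g ξ) (j : Fin K) :
    Measurable fun y : S × RoundNoise X K L =>
      roundEstimate M X (h y.1) (x y.1) (l y.1) y.2 j :=
  H.isOracle.measurable_roundEstimate (S := S × RoundNoise X K L) (h := fun y => h y.1)
    (x := fun y => x y.1)
    (fun p hp => (H.hist_measurable p hp).comp measurable_fst)
    (fun p hp j => (H.context_measurable p hp j).preimage measurable_fst)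
    (H.loss_measurable.comp measurable_fst) measurable_snd j

lemma measurable_prob (H : IsRound mS P M X ε μ h x l g ξ) (j : Fin K) :
    Measurable fun y : S × RoundNoise X K L => selProb M X ε (h y.1) (x y.1) j :=
  (H.isOracle.measurable_selProb H.hist_measurable H.context_measurable H.eps_pos j).comp
    measurable_fst

lemma measurable_sum_prob_mul_estimate (H : IsRound mS P M X ε μ h x l g ξ) :
    Measurable fun y : S × RoundNoise X K L =>
      ∑ j, selProb M X ε (h y.1) (x y.1) j * roundEstimate M X (h y.1) (x y.1) (l y.1) y.2 j :=
  Finset.measurable_sum _ fun j _ => (H.measurable_prob j).mul (H.measurable_estimate j)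

lemma measurable_actionLoss (H : IsRound mS P M X ε μ h x l g ξ) {p : Policy C K} (hp : p ∈ P)
    {f : S × RoundNoise X K L → Fin K → ℝ} (hf : ∀ j, Measurable fun y => f y j) :
    Measurable fun y : S × RoundNoise X K L => actionLoss (p (x y.1)) (f y) := by
  simp only [actionLoss_eq_sum_indicator]
  exact Finset.measurable_sum _ fun j _ => Measurable.ite
    ((H.context_measurable p hp j).preimage measurable_fst) (hf j) measurable_const

lemma measurable_actionLoss_leader (H : IsRound mS P M X ε μ h x l g ξ) :
    Measurable fun y : S × RoundNoise X K L =>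
      actionLoss (ftplPolicy M X (h y.1) y.2.1 (x y.1)) (l y.1) := by
  simp only [actionLoss_eq_sum_indicator]
  refine Finset.measurable_sum _ fun j _ => Measurable.ite ?_
    ((measurable_pi_apply j).comp (H.loss_measurable.comp measurable_fst)) measurable_const
  exact H.isOracle.measurableSet_ftplPolicy (S := S × RoundNoise X K L) (h := fun y => h y.1)
    (fun p hp => (H.hist_measurable p hp).comp measurable_fst) measurable_snd.fst
    (fun y p => j ∈ p (x y.1))
    fun p hp => (H.context_measurable p hp j).preimage measurable_fst

lemma integrable_comp (H : IsRound mS P M X ε μ h x l g ξ) {F : S × RoundNoise X K L → ℝ}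
    (hF : Measurable F) {b : Ω → ℝ} (hb : Integrable b μ) (hFb : ∀ ω, |F (g ω, ξ ω)| ≤ b ω) :
    Integrable (fun ω => F (g ω, ξ ω)) μ :=
  hb.mono' (hF.comp (H.past_measurable.prodMk H.noise_measurable)).aestronglyMeasurable
    (Filter.Eventually.of_forall hFb)

/-- The regret of a round with respect to `p` for the true losses. -/
lemma integrable_regret [IsProbabilityMeasure μ] (H : IsRound mS P M X ε μ h x l g ξ)
    {p : Policy C K} (hp : p ∈ P) :
    Integrable (fun ω => actionLoss (ftplPolicy M X (h (g ω)) (ξ ω).1 (x (g ω))) (l (g ω))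
      - actionLoss (p (x (g ω))) (l (g ω))) μ := by
  refine H.integrable_comp (F := fun y => actionLoss (ftplPolicy M X (h y.1) y.2.1 (x y.1)) (l y.1)
      - actionLoss (p (x y.1)) (l y.1)) (H.measurable_actionLoss_leader.sub
      (H.measurable_actionLoss hp fun j =>
        (measurable_pi_apply j).comp (H.loss_measurable.comp measurable_fst)))
    (H.norm_integrable.const_mul (K : ℝ)) fun ω => ?_
  have h1 := actionLoss_le_selNorm (H.isOracle.mem (fakeSamples X (ξ ω).1 ++ h (g ω)))
    (x (g ω)) (l (g ω))
  have h2 := actionLoss_le_selNorm hp (x (g ω)) (l (g ω))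
  exact abs_sub_le_of_nonneg_of_le (actionLoss_nonneg (H.loss_nonneg _) _) h1
    (actionLoss_nonneg (H.loss_nonneg _) _) h2

/-- The regret of a round with respect to `p` for the estimated losses. -/
lemma integrable_estimated_regret [IsProbabilityMeasure μ] (H : IsRound mS P M X ε μ h x l g ξ)
    {p : Policy C K} (hp : p ∈ P) :
    Integrable (fun ω => (∑ j, selProb M X ε (h (g ω)) (x (g ω)) j
        * roundEstimate M X (h (g ω)) (x (g ω)) (l (g ω)) (ξ ω) j)
      - actionLoss (p (x (g ω))) (roundEstimate M X (h (g ω)) (x (g ω)) (l (g ω)) (ξ ω))) μ := by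
  refine H.integrable_comp (F := fun y => (∑ j, selProb M X ε (h y.1) (x y.1) j
        * roundEstimate M X (h y.1) (x y.1) (l y.1) y.2 j)
      - actionLoss (p (x y.1)) (roundEstimate M X (h y.1) (x y.1) (l y.1) y.2))
    (H.measurable_sum_prob_mul_estimate.sub (H.measurable_actionLoss hp H.measurable_estimate))
    (H.norm_integrable.const_mul ((K : ℝ) * L)) fun ω => ?_
  have h0 := H.loss_nonneg (g ω)
  have h1 := H.isOracle.sum_roundEstimate_le (h (g ω)) (x (g ω)) h0 (ξ ω)
  rw [← mul_assoc] at h1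
  exact abs_sub_le_of_nonneg_of_le (sum_selProb_mul_roundEstimate_nonneg _ _ h0 _)
    ((sum_selProb_mul_roundEstimate_le H.eps_pos _ _ h0 _).trans h1)
    (actionLoss_nonneg (roundEstimate_nonneg _ _ h0 _) _)
    ((actionLoss_le_sum (roundEstimate_nonneg _ _ h0 _) _).trans h1)

/-- The expected regret of a round is bounded by the expected estimated regret and the bias that
is caused by the truncation of the resampling. -/
lemma integral_regret_le [IsProbabilityMeasure μ] (H : IsRound mS P M X ε μ h x l g ξ)
    (hL : 1 ≤ L) {p : Policy C K} (hp : p ∈ P) :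
    ∫ ω, (actionLoss (ftplPolicy M X (h (g ω)) (ξ ω).1 (x (g ω))) (l (g ω))
        - actionLoss (p (x (g ω))) (l (g ω))) ∂μ
      ≤ ∫ ω, ((∑ j, selProb M X ε (h (g ω)) (x (g ω)) j
          * roundEstimate M X (h (g ω)) (x (g ω)) (l (g ω)) (ξ ω) j)
        - actionLoss (p (x (g ω)))
          (roundEstimate M X (h (g ω)) (x (g ω)) (l (g ω)) (ξ ω))) ∂μ
        + K / (Real.exp 1 * L) * ∫ ω, selNorm P (l (g ω)) ∂μ := by
  have hI := (H.integrable_regret hp).sub (H.integrable_estimated_regret hp)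
  have key := integral_comp_of_indepFun H.past_measurable H.noise_measurable H.indep H.noise_law
    (F := fun y => actionLoss (ftplPolicy M X (h y.1) y.2.1 (x y.1)) (l y.1)
      - actionLoss (p (x y.1)) (l y.1)
      - ((∑ j, selProb M X ε (h y.1) (x y.1) j
        * roundEstimate M X (h y.1) (x y.1) (l y.1) y.2 j)
      - actionLoss (p (x y.1)) (roundEstimate M X (h y.1) (x y.1) (l y.1) y.2)))
    ((H.measurable_actionLoss_leader.sub (H.measurable_actionLoss hp fun j =>
        (measurable_pi_apply j).comp (H.loss_measurable.comp measurable_fst))).sub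
      (H.measurable_sum_prob_mul_estimate.sub (H.measurable_actionLoss hp H.measurable_estimate)))
    hI
  have hle := integral_mono key.1 (H.norm_integrable.const_mul (K / (Real.exp 1 * L)))
    fun ω => H.isOracle.integral_bias_le H.eps_pos hL (h (g ω)) (x (g ω)) (H.loss_nonneg (g ω)) p
  rw [← key.2, integral_const_mul, integral_sub (H.integrable_regret hp)
    (H.integrable_estimated_regret hp)] at hle
  linarith

lemma integral_sum_mul_sum_le [IsProbabilityMeasure μ] (H : IsRound mS P M X ε μ h x l g ξ) {m : ℕ}
    (hm : ∀ p ∈ P, ∀ x, (p x).card ≤ m) :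
    Integrable (fun ω => (∑ i, roundEstimate M X (h (g ω)) (x (g ω)) (l (g ω)) (ξ ω) i)
        * ∑ j, selProb M X ε (h (g ω)) (x (g ω)) j
          * roundEstimate M X (h (g ω)) (x (g ω)) (l (g ω)) (ξ ω) j) μ ∧
    ∫ ω, (∑ i, roundEstimate M X (h (g ω)) (x (g ω)) (l (g ω)) (ξ ω) i)
        * (∑ j, selProb M X ε (h (g ω)) (x (g ω)) j
          * roundEstimate M X (h (g ω)) (x (g ω)) (l (g ω)) (ξ ω) j) ∂μ
      ≤ 2 * m * K * ∫ ω, selNorm P (l (g ω)) ^ 2 ∂μ := by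
  have hF : Measurable fun y : S × RoundNoise X K L =>
      (∑ i, roundEstimate M X (h y.1) (x y.1) (l y.1) y.2 i) * ∑ j, selProb M X ε (h y.1) (x y.1) j
        * roundEstimate M X (h y.1) (x y.1) (l y.1) y.2 j :=
    (Finset.measurable_sum _ fun j _ => H.measurable_estimate j).mul
      H.measurable_sum_prob_mul_estimate
  have hI := H.integrable_comp hF (H.sq_integrable.const_mul (((K : ℝ) * L) ^ 2)) fun ω => by
    have h0 := H.loss_nonneg (g ω)
    have h1 := H.isOracle.sum_roundEstimate_le (h (g ω)) (x (g ω)) h0 (ξ ω)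
    have h2 := sum_selProb_mul_roundEstimate_le (M := M) H.eps_pos (h (g ω)) (x (g ω)) h0 (ξ ω)
    have h3 := sum_selProb_mul_roundEstimate_nonneg (M := M) (ε := ε) (h (g ω)) (x (g ω)) h0 (ξ ω)
    rw [abs_of_nonneg (mul_nonneg (h3.trans h2) h3), ← mul_pow, mul_assoc, sq]
    exact mul_le_mul h1 (h2.trans h1) h3 (h3.trans (h2.trans h1))
  have key := integral_comp_of_indepFun H.past_measurable H.noise_measurable H.indep H.noise_law
    hF hI
  refine ⟨hI, ?_⟩
  rw [key.2, ← integral_const_mul]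
  exact integral_mono key.1 (H.sq_integrable.const_mul _) fun ω =>
    H.isOracle.integral_sum_mul_sum_le hm H.eps_pos (h (g ω)) (x (g ω)) (H.loss_nonneg (g ω))

lemma integral_sq_sum_le [IsProbabilityMeasure μ] (H : IsRound mS P M X ε μ h x l g ξ) {m : ℕ}
    (hm : ∀ p ∈ P, ∀ x, (p x).card ≤ m) :
    Integrable (fun ω => (∑ i, roundEstimate M X (h (g ω)) (x (g ω)) (l (g ω)) (ξ ω) i) ^ 2) μ ∧
    ∫ ω, (∑ i, roundEstimate M X (h (g ω)) (x (g ω)) (l (g ω)) (ξ ω) i) ^ 2 ∂μ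
      ≤ m * K * L * ∫ ω, selNorm P (l (g ω)) ^ 2 ∂μ := by
  have hF : Measurable fun y : S × RoundNoise X K L =>
      (∑ i, roundEstimate M X (h y.1) (x y.1) (l y.1) y.2 i) ^ 2 :=
    (Finset.measurable_sum _ fun j _ => H.measurable_estimate j).pow_const 2
  have hI := H.integrable_comp hF (H.sq_integrable.const_mul (((K : ℝ) * L) ^ 2)) fun ω => by
    have h0 := H.loss_nonneg (g ω)
    have h1 := H.isOracle.sum_roundEstimate_le (h (g ω)) (x (g ω)) h0 (ξ ω)
    rw [abs_of_nonneg (sq_nonneg _), ← mul_pow, mul_assoc]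
    exact pow_le_pow_left₀ (Finset.sum_nonneg fun j _ => roundEstimate_nonneg _ _ h0 _ j) h1 2
  have key := integral_comp_of_indepFun H.past_measurable H.noise_measurable H.indep H.noise_law
    hF hI
  refine ⟨hI, ?_⟩
  rw [key.2, ← integral_const_mul]
  exact integral_mono key.1 (H.sq_integrable.const_mul _) fun ω =>
    H.isOracle.integral_sq_sum_le hm H.eps_pos (h (g ω)) (x (g ω)) (H.loss_nonneg (g ω))

end IsRound

/-! ### The regret of follow the perturbed leader -/

/-- The regret of the perturbed leader against a fixed sequence of losses. -/
lemma IsOracle.ftpl_regret_le {C : Type*} {K : ℕ} {P : Finset (Policy C K)}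
    {M : List (Outcome C K) → Policy C K} {X : Finset C} (hM : IsOracle P M) {m : ℕ}
    (hm : ∀ p ∈ P, ∀ x, (p x).card ≤ m) {ε : ℝ} (hε : 0 < ε) {p : Policy C K} (hp : p ∈ P)
    (h : ℕ → List (Outcome C K)) (x : ℕ → C) (l : ℕ → Fin K → ℝ) (h0 : h 0 = [])
    (hs : ∀ t, h (t + 1) = h t ++ [(x t, l t)]) (T : ℕ) :
    ∑ t ∈ Finset.range T, ((∑ j, selProb M X ε (h t) (x t) j * l t j)
        - actionLoss (p (x t)) (l t))
      ≤ 10 / ε * √((X.card : ℝ) * m) * Real.log P.card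
        + ∑ t ∈ Finset.range T, ∫ z, (actionLoss (ftplPolicy M X (h t) z (x t)) (l t)
          - actionLoss (ftplPolicy M X (h t ++ [(x t, l t)]) z (x t)) (l t)) ∂(fakeLaw X K ε) := by
  have := isProbabilityMeasure_fakeLaw X K hε
  have hi : ∀ t t', Integrable (fun z => actionLoss (ftplPolicy M X (h t') z (x t)) (l t))
      (fakeLaw X K ε) := fun t t' =>
    hM.integrable_ftplPolicy_comp (h t') (fun p => actionLoss (p (x t)) (l t)) hε
  -- The same z is used in all rounds. This is legitimate because the left side of the claim
  -- involves only the law of each round's leader, and the sequence of losses is fixed.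
  have hpt : ∀ z : FakeLosses X K,
      ∑ t ∈ Finset.range T, actionLoss (ftplPolicy M X (h (t + 1)) z (x t)) (l t)
      ≤ (cumLoss p (fakeSamples X z) - cumLoss (ftplPolicy M X [] z) (fakeSamples X z))
        + ∑ t ∈ Finset.range T, actionLoss (p (x t)) (l t) := by
    intro z
    have h1 := hM.be_the_leader (fakeSamples X z) h x l h0 hs T
    have h2 := hM.isMin (fakeSamples X z ++ h T) p hp
    rw [cumLoss_append p, cumLoss_eq_sum p h x l h0 hs] at h2
    simp only [ftplPolicy, List.append_nil]
    linarith
  have hint := integral_mono (integrable_finsetSum (Finset.range T) fun t _ => hi t (t + 1))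
    (((integrable_cumLoss_fakeSamples p hε).sub
      (hM.integrable_cumLoss_ftplPolicy [] hε)).add (integrable_const _)) hpt
  have hadd := integral_add ((integrable_cumLoss_fakeSamples p hε).sub
      (hM.integrable_cumLoss_ftplPolicy (X := X) [] hε))
      (integrable_const (∑ t ∈ Finset.range T, actionLoss (p (x t)) (l t)))
  simp only [Pi.sub_apply, integral_const, probReal_univ, smul_eq_mul, one_mul] at hadd
  rw [integral_finsetSum _ fun t _ => hi t (t + 1)] at hint
  simp only [Pi.add_apply, Pi.sub_apply] at hint
  rw [hadd] at hint
  have hnoise := hM.integral_noise_le (X := X) hm hε hp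
  -- Each stability term is exactly the gap between the leader's expected loss and that of the
  -- leader which already knows the outcome of the round.
  have hstab : ∀ t, ∫ z, (actionLoss (ftplPolicy M X (h t) z (x t)) (l t)
      - actionLoss (ftplPolicy M X (h t ++ [(x t, l t)]) z (x t)) (l t)) ∂(fakeLaw X K ε)
      = ∑ j, selProb M X ε (h t) (x t) j * l t j
        - ∫ z, actionLoss (ftplPolicy M X (h (t + 1)) z (x t)) (l t) ∂(fakeLaw X K ε) := by
    intro t
    rw [← hs, integral_sub (hi t t) (hi t (t + 1)), hM.integral_actionLoss_ftplPolicy _ hε]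
  simp only [hstab, Finset.sum_sub_distrib]
  linarith

/-! ### From single rounds to the whole interaction. -/

namespace Run

variable {K m d N T L : ℕ} {ε : ℝ} (R : Run.{u, v} K m d N T L ε)

/-- The estimated history before round `t`. -/
noncomputable def hist (t : ℕ) (ω : R.Ω) : List (Outcome R.C K) :=
  estHistory R.M R.X (fun s => R.context s ω) (fun s => R.loss s ω) (fun s => R.noise s ω) t

/-- The estimated losses of round `t`. -/
noncomputable def est (t : ℕ) (ω : R.Ω) : Fin K → ℝ :=
  roundEstimate R.M R.X (R.hist t ω) (R.context t ω) (R.loss t ω) (R.noise t ω)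

lemma hist_succ (t : ℕ) (ω : R.Ω) :
    R.hist (t + 1) ω = R.hist t ω ++ [(R.context t ω, R.est t ω)] := rfl

lemma measurableSet_context {t : ℕ} (ht : t < T) {p : Policy R.C K} (hp : p ∈ R.policies)
    (j : Fin K) : MeasurableSet[R.ℱ t] {ω | j ∈ p (R.context t ω)} :=
  R.context_measurable t ht (R.policies_measurable p hp j)

/-- The history before round t uses only earlier noise, hence is known to `ℱ t`. Cumulative losses
are enough because the oracle depends on a list only through them, so no σ-algebra on lists is
needed. -/
lemma measurable_cumLoss_hist {t : ℕ} (ht : t ≤ T) :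
    ∀ p ∈ R.policies, Measurable[R.ℱ t] fun ω => cumLoss p (R.hist t ω) := by
  induction t with
  | zero =>
    intro p _
    have : (fun ω => cumLoss p (R.hist 0 ω)) = fun _ => 0 := by
      funext ω
      exact cumLoss_nil p
    rw [this]
    exact measurable_const
  | succ t ih =>
    intro p hp
    have hmono : R.ℱ t ≤ R.ℱ (t + 1) := R.ℱ.mono (Nat.le_succ t)
    have hest : ∀ j, Measurable[R.ℱ (t + 1)] fun ω => R.est t ω j :=
      R.isOracle.measurable_roundEstimate (S := R.Ω)
        (fun p hp => (ih (by omega) p hp).mono hmono le_rfl)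
        (fun p hp j => hmono _ (R.measurableSet_context ht hp j))
        ((R.loss_measurable t ht).mono hmono le_rfl) (R.noise_measurable t ht)
    simp only [hist_succ, cumLoss_append, cumLoss_singleton, actionLoss_eq_sum_indicator]
    refine ((ih (by omega) p hp).mono hmono le_rfl).add (Finset.measurable_sum _ fun j _ => ?_)
    exact Measurable.ite (hmono _ (R.measurableSet_context ht hp j)) (hest j) measurable_const

/-- The past is the identity map from Ω to Ω carrying the σ-algebra `ℱ t`: functions of the past are
the `ℱ t`-measurable ones, and independence from this map is independence from `ℱ t`. -/
lemma isRound (hε : 0 < ε) {t : ℕ} (ht : t < T) :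
    IsRound (R.ℱ t) R.policies R.M R.X ε R.μ (R.hist t) (R.context t) (R.loss t) id
      (R.noise t) where
  isOracle := R.isOracle
  eps_pos := hε
  hist_measurable := R.measurable_cumLoss_hist ht.le
  context_measurable _ hp j := R.measurableSet_context ht hp j
  loss_measurable := R.loss_measurable t ht
  loss_nonneg := R.loss_nonneg t ht
  past_measurable := measurable_id'' (R.ℱ.le t)
  noise_measurable := (R.noise_measurable t ht).mono (R.ℱ.le _) le_rfl
  indep := by
    refine (@IndepFun_iff_Indep _ _ _ _ (R.ℱ t) _ _ _ _).2 ?_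
    rw [MeasurableSpace.comap_id]
    exact (R.noise_indep t ht).symm
  noise_law := R.noise_law t ht
  sq_integrable := R.loss_sq_integrable t ht

lemma policies_nonempty : Nonempty {p : Policy R.C K // p ∈ R.policies} :=
  ⟨⟨_, R.isOracle.mem []⟩⟩

/-- The regret is bounded by the cost of the perturbation, the stability terms, and the bias of
the estimates. -/
lemma regret_le (hε : 0 < ε) (hL : 1 ≤ L) (b : ℕ → R.Ω → ℝ)
    (hbi : ∀ t < T, Integrable (b t) R.μ)
    (hb : ∀ t < T, ∀ ω, ∫ z, (actionLoss (ftplPolicy R.M R.X (R.hist t ω) z (R.context t ω))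
        (R.est t ω) - actionLoss (ftplPolicy R.M R.X (R.hist t ω ++ [(R.context t ω, R.est t ω)]) z
          (R.context t ω)) (R.est t ω)) ∂(fakeLaw R.X K ε) ≤ b t ω) :
    R.regret ≤ ∑ t ∈ Finset.range T, ∫ ω, b t ω ∂(R.μ)
      + 10 / ε * √((d : ℝ) * m) * Real.log N + K / (Real.exp 1 * L) * R.sumLoss := by
  have := R.policies_nonempty
  refine ciSup_le fun ⟨p, hp⟩ => ?_
  simp only [← Finset.sum_sub_distrib]
  have hreg : ∀ t ∈ Finset.range T, Integrable (fun ω =>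
      actionLoss (R.played t ω (R.context t ω)) (R.loss t ω)
      - actionLoss (p (R.context t ω)) (R.loss t ω)) R.μ := fun t ht =>
    (R.isRound hε (Finset.mem_range.1 ht)).integrable_regret hp
  have hest : ∀ t ∈ Finset.range T, Integrable (fun ω =>
      (∑ j, selProb R.M R.X ε (R.hist t ω) (R.context t ω) j * R.est t ω j)
      - actionLoss (p (R.context t ω)) (R.est t ω)) R.μ := fun t ht =>
    (R.isRound hε (Finset.mem_range.1 ht)).integrable_estimated_regret hp
  have hbi' : ∀ t ∈ Finset.range T, Integrable (b t) R.μ := fun t ht =>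
    hbi t (Finset.mem_range.1 ht)
  rw [integral_finsetSum _ hreg]
  have h1 : ∑ t ∈ Finset.range T, ∫ ω, (actionLoss (R.played t ω (R.context t ω)) (R.loss t ω)
      - actionLoss (p (R.context t ω)) (R.loss t ω)) ∂(R.μ)
      ≤ ∑ t ∈ Finset.range T, (∫ ω,
        ((∑ j, selProb R.M R.X ε (R.hist t ω) (R.context t ω) j * R.est t ω j)
          - actionLoss (p (R.context t ω)) (R.est t ω)) ∂(R.μ)
        + K / (Real.exp 1 * L) * ∫ ω, selNorm R.policies (R.loss t ω) ∂(R.μ)) :=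
    Finset.sum_le_sum fun t ht => (R.isRound hε (Finset.mem_range.1 ht)).integral_regret_le hL hp
  rw [Finset.sum_add_distrib, ← Finset.mul_sum, ← integral_finsetSum _ hest] at h1
  -- Along a path ω the estimates are a deterministic sequence, so the bound for fixed losses
  -- applies; the analysis noise z is unrelated to the noise on the path.
  have hpt : ∀ ω, ∑ t ∈ Finset.range T,
      ((∑ j, selProb R.M R.X ε (R.hist t ω) (R.context t ω) j * R.est t ω j)
          - actionLoss (p (R.context t ω)) (R.est t ω))
      ≤ 10 / ε * √((d : ℝ) * m) * Real.log N + ∑ t ∈ Finset.range T, b t ω := by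
    intro ω
    have := R.isOracle.ftpl_regret_le (X := R.X) R.card_action_le hε hp (fun t => R.hist t ω)
      (fun t => R.context t ω) (fun t => R.est t ω) rfl (fun t => R.hist_succ t ω) T
    rw [R.card_X, R.card_policies] at this
    exact this.trans (add_le_add_right
      (Finset.sum_le_sum fun t ht => hb t (Finset.mem_range.1 ht) ω) _)
  have h2 := integral_mono (integrable_finsetSum _ hest)
    ((integrable_const (10 / ε * √((d : ℝ) * m) * Real.log N)).add
      (integrable_finsetSum _ hbi')) hpt
  have h3 : ∫ ω, (((fun _ => 10 / ε * √((d : ℝ) * m) * Real.log N) : R.Ω → ℝ)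
      + fun ω => ∑ t ∈ Finset.range T, b t ω) ω ∂(R.μ)
      = 10 / ε * √((d : ℝ) * m) * Real.log N + ∑ t ∈ Finset.range T, ∫ ω, b t ω ∂(R.μ) := by
    rw [integral_add' (integrable_const _) (integrable_finsetSum _ hbi'),
      integral_finsetSum _ hbi']
    simp
  rw [h3] at h2
  unfold sumLoss
  linarith

lemma sumSqLoss_nonneg : 0 ≤ R.sumSqLoss :=
  Finset.sum_nonneg fun _ _ => integral_nonneg fun _ => sq_nonneg _

lemma est_nonneg {t : ℕ} (ht : t < T) (ω : R.Ω) (j : Fin K) : 0 ≤ R.est t ω j :=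
  roundEstimate_nonneg _ _ (R.loss_nonneg t ht ω) _ j

lemma regret_le_of_transductive (hε : 0 < ε) (hL : 1 ≤ L) (hR : R.Transductive) :
    R.regret ≤ 2 * ε * m * K * R.sumSqLoss + 10 / ε * √((d : ℝ) * m) * Real.log N
      + K / (Real.exp 1 * L) * R.sumLoss := by
  have hround := fun t (ht : t < T) =>
    (R.isRound hε ht).integral_sum_mul_sum_le R.card_action_le
  refine (R.regret_le hε hL (fun t ω => ε * ((∑ i, R.est t ω i) *
    ∑ j, selProb R.M R.X ε (R.hist t ω) (R.context t ω) j * R.est t ω j))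
    (fun t ht => (hround t ht).1.const_mul ε) fun t ht ω => ?_).trans ?_
  · rw [← mul_assoc]
    exact R.isOracle.stability_transductive _ hε (hR t ht ω) (R.est_nonneg ht ω)
  · gcongr
    unfold sumSqLoss
    rw [Finset.mul_sum]
    refine Finset.sum_le_sum fun t ht => ?_
    rw [integral_const_mul]
    have := mul_le_mul_of_nonneg_left (hround t (Finset.mem_range.1 ht)).2 hε.le
    exact this.trans (le_of_eq (by ring_nf; rfl))

lemma regret_le_of_smallSeparator (hε : 0 < ε) (hL : 1 ≤ L) (hR : R.SmallSeparator) :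
    R.regret ≤ 8 * ε * (K : ℝ) ^ 2 * d * L * m * R.sumSqLoss
      + 10 / ε * √((d : ℝ) * m) * Real.log N + K / (Real.exp 1 * L) * R.sumLoss := by
  have hround := fun t (ht : t < T) =>
    (R.isRound hε ht).integral_sq_sum_le R.card_action_le
  refine (R.regret_le hε hL (fun t ω => 2 * ε * d * K * (∑ i, R.est t ω i) ^ 2)
    (fun t ht => (hround t ht).1.const_mul _) fun t ht ω => ?_).trans ?_
  · have h := R.isOracle.stability_separator hR (R.hist t ω) hε (R.context t ω)
      (R.est_nonneg ht ω)
    rwa [R.card_X] at h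
  · have h1 : ∑ t ∈ Finset.range T, ∫ ω, 2 * ε * d * K * (∑ i, R.est t ω i) ^ 2 ∂(R.μ)
        ≤ 2 * ε * (K : ℝ) ^ 2 * d * L * m * R.sumSqLoss := by
      unfold sumSqLoss
      rw [Finset.mul_sum]
      refine Finset.sum_le_sum fun t ht => ?_
      rw [integral_const_mul]
      have := mul_le_mul_of_nonneg_left (hround t (Finset.mem_range.1 ht)).2
        (by positivity : 0 ≤ 2 * ε * d * K)
      exact this.trans (le_of_eq (by ring_nf; rfl))
    -- The argument yields the constant 2; the stated 8 leaves room.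
    have h2 : 2 * ε * (K : ℝ) ^ 2 * d * L * m * R.sumSqLoss
        ≤ 8 * ε * (K : ℝ) ^ 2 * d * L * m * R.sumSqLoss := by
      have := R.sumSqLoss_nonneg
      gcongr
      norm_num
    linarith

/-! ### Bounded losses and degenerate cases -/

/-- Covers the cases in which a tuned bound vanishes and balancing is impossible. The comparison is
pointwise, so no integrability is needed. -/
lemma regret_nonpos_of_forall (h : ∀ p ∈ R.policies, ∀ t < T, ∀ ω,
    actionLoss (R.played t ω (R.context t ω)) (R.loss t ω)
      ≤ actionLoss (p (R.context t ω)) (R.loss t ω)) : R.regret ≤ 0 := by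
  have := R.policies_nonempty
  refine ciSup_le fun ⟨p, hp⟩ => integral_nonpos fun ω => ?_
  exact sub_nonpos.2 (Finset.sum_le_sum fun t ht => h p hp t (Finset.mem_range.1 ht) ω)

lemma played_mem (t : ℕ) (ω : R.Ω) : R.played t ω ∈ R.policies := R.isOracle.mem _

lemma regret_nonpos_of_card_le_one (hN : N ≤ 1) : R.regret ≤ 0 := by
  refine R.regret_nonpos_of_forall fun p hp t _ ω => ?_
  rw [Finset.card_le_one.1 (R.card_policies.le.trans hN) _ (R.played_mem t ω) _ hp]

lemma regret_nonpos_of_actions_eq_zero (hm : m = 0) : R.regret ≤ 0 := by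
  refine R.regret_nonpos_of_forall fun p hp t ht ω => ?_
  have : R.played t ω (R.context t ω) = ∅ := by
    simpa [hm] using R.card_action_le _ (R.played_mem t ω) (R.context t ω)
  rw [this]
  exact actionLoss_nonneg (R.loss_nonneg t ht ω) _

lemma regret_nonpos_of_coordinates_eq_zero (hK : K = 0) : R.regret ≤ 0 := by
  subst hK
  exact R.regret_nonpos_of_forall fun p hp t ht ω => by
    simp [actionLoss, Finset.eq_empty_of_isEmpty]

lemma regret_nonpos_of_rounds_eq_zero (hT : T = 0) : R.regret ≤ 0 :=
  R.regret_nonpos_of_forall fun p hp t ht ω => by omega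

lemma regret_nonpos_of_transductive (hd : d = 0) (hR : R.Transductive) : R.regret ≤ 0 := by
  refine R.regret_nonpos_of_forall fun p hp t ht ω => ?_
  have h1 := hR t ht ω
  rw [Finset.card_eq_zero.1 (R.card_X.trans hd)] at h1
  simp at h1

lemma regret_nonpos_of_smallSeparator (hd : d = 0) (hR : R.SmallSeparator) : R.regret ≤ 0 := by
  refine R.regret_nonpos_of_card_le_one ?_
  rw [← R.card_policies, Finset.card_le_one]
  intro p hp q hq
  by_contra hpq
  obtain ⟨x, hx, -⟩ := hR p hp q hq hpq
  rw [Finset.card_eq_zero.1 (R.card_X.trans hd)] at hx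
  simp at hx

lemma sumLoss_le (hR : R.LossLeOne) : R.sumLoss ≤ T := by
  refine (Finset.sum_le_card_nsmul _ _ 1 fun t ht => ?_).trans (by simp)
  have := integral_mono_of_nonneg (μ := R.μ)
    (Filter.Eventually.of_forall fun ω => selNorm_nonneg R.policies (R.loss t ω))
    (integrable_const 1) (Filter.Eventually.of_forall fun ω => hR t (Finset.mem_range.1 ht) ω)
  simpa using this

lemma sumSqLoss_le (hR : R.LossLeOne) : R.sumSqLoss ≤ T := by
  refine (Finset.sum_le_card_nsmul _ _ 1 fun t ht => ?_).trans (by simp)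
  have := integral_mono_of_nonneg (μ := R.μ)
    (Filter.Eventually.of_forall fun ω => sq_nonneg (selNorm R.policies (R.loss t ω)))
    (integrable_const 1) (Filter.Eventually.of_forall fun ω =>
      pow_le_one₀ (n := 2) (selNorm_nonneg R.policies (R.loss t ω)) (hR t (Finset.mem_range.1 ht) ω))
  simpa using this

end Run

/-! ### The choice of the parameters -/

/-- The minimizer of ε a + b / ε is √(b / a). -/
lemma exists_balancing {a b : ℝ} (ha : 0 < a) (hb : 0 < b) :
    ∃ ε : ℝ, 0 < ε ∧ ε * a + b / ε = 2 * √(a * b) := by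
  refine ⟨√b / √a, by positivity, ?_⟩
  have h1 : √a ^ 2 = a := Real.sq_sqrt ha.le
  have h2 : √b ^ 2 = b := Real.sq_sqrt hb.le
  have h3 : 0 < √a := Real.sqrt_pos.2 ha
  have h4 : 0 < √b := Real.sqrt_pos.2 hb
  rw [Real.sqrt_mul ha.le]
  have h5 : √b / √a * a = √a * √b := by
    field_simp
    rw [h1]
  have h6 : b / (√b / √a) = √a * √b := by
    field_simp
    rw [h2]
  rw [h5, h6]
  ring

lemma rpow_quarter_sq {a : ℝ} (ha : 0 ≤ a) : (a ^ (1 / 4 : ℝ)) ^ 2 = √a := by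
  rw [← Real.rpow_natCast, ← Real.rpow_mul ha, Real.sqrt_eq_rpow]
  norm_num

lemma rpow_three_quarters_sq {a : ℝ} (ha : 0 ≤ a) : (a ^ (3 / 4 : ℝ)) ^ 2 = a * √a := by
  rw [← Real.rpow_natCast, ← Real.rpow_mul ha, Real.sqrt_eq_rpow]
  conv_rhs => rw [← Real.rpow_one a, ← Real.rpow_mul ha]
  rw [← Real.rpow_add_of_nonneg ha (by norm_num) (by norm_num)]
  norm_num

lemma exists_parameters_transductive {K m d T : ℝ} (hK : 1 ≤ K) (hm : 1 ≤ m) (hd : 1 ≤ d)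
    (hT : 1 ≤ T) {l : ℝ} (hl : 1 / 2 ≤ l) :
    ∃ (ε : ℝ) (L : ℕ), 0 < ε ∧ 1 ≤ L ∧
      2 * ε * m * K * T + 10 / ε * √(d * m) * l + K / (Real.exp 1 * L) * T
        ≤ 30 * d ^ (1 / 4 : ℝ) * m ^ (3 / 4 : ℝ) * √(K * T * l) := by
  set B := d ^ (1 / 4 : ℝ) * m ^ (3 / 4 : ℝ) * √(K * T * l) with hB
  have hB0 : 0 < B := by positivity
  have hB2 : B ^ 2 = √(d * m) * m * (K * T * l) := by
    rw [hB, mul_pow, mul_pow, rpow_quarter_sq (by linarith), rpow_three_quarters_sq (by linarith),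
      Real.sq_sqrt (by positivity), Real.sqrt_mul (by linarith)]
    ring
  obtain ⟨ε, hε, hbal⟩ := exists_balancing (a := 2 * m * K * T) (b := 10 * √(d * m) * l)
    (by positivity) (by positivity)
  -- The product under the root is 20 B², and 20 ≤ 25.
  have hsqrt : √(2 * m * K * T * (10 * √(d * m) * l)) ≤ 5 * B := by
    refine Real.sqrt_le_iff.2 ⟨by positivity, ?_⟩
    rw [mul_pow, hB2]
    have : 0 ≤ √(d * m) * m * (K * T * l) := by positivity
    linarith
  -- In the transductive bound L enters only through the bias, so it may be as large as needed to
  -- push the bias below `B`.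
  refine ⟨ε, ⌈K * T / B⌉₊ + 1, hε, by omega, ?_⟩
  have hL : K * T / B ≤ ((⌈K * T / B⌉₊ + 1 : ℕ) : ℝ) := by
    push_cast
    linarith [Nat.le_ceil (K * T / B)]
  set L := ((⌈K * T / B⌉₊ + 1 : ℕ) : ℝ)
  have hL0 : 0 < L := lt_of_lt_of_le (by positivity) hL
  have h1 : K / (Real.exp 1 * L) * T ≤ B := by
    rw [div_mul_eq_mul_div, div_le_iff₀ (by positivity)]
    have h2 := (div_le_iff₀ hB0).1 hL
    have h3 : 1 ≤ Real.exp 1 := Real.one_le_exp zero_le_one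
    have h4 : 0 ≤ L * B := by positivity
    nlinarith
  calc _ = (ε * (2 * m * K * T) + 10 * √(d * m) * l / ε) + K / (Real.exp 1 * L) * T := by ring
    _ ≤ 2 * (5 * B) + B := by rw [hbal]; linarith
    _ ≤ 30 * B := by linarith
    _ = _ := by rw [hB]; ring

lemma exists_parameters_separator {K m d T : ℝ} (hK : 1 ≤ K) (hm : 1 ≤ m) (hd : 1 ≤ d)
    (hT : 1 ≤ T) {l : ℝ} (hl : 1 / 2 ≤ l) :
    ∃ (ε : ℝ) (L : ℕ), 0 < ε ∧ 1 ≤ L ∧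
      8 * ε * K ^ 2 * d * L * m * T + 10 / ε * √(d * m) * l + K / (Real.exp 1 * L) * T
        ≤ 30 * T ^ (2 / 3 : ℝ) * d ^ (3 / 4 : ℝ) * m ^ (3 / 4 : ℝ) * K * √l := by
  -- As functions of T and L, the balanced terms grow like √(LT) and the bias like T / L; they meet
  -- at L = T^(1/3).
  set U := T ^ (1 / 3 : ℝ) with hU
  have hU1 : 1 ≤ U := Real.one_le_rpow hT (by norm_num)
  have hTU : T = U ^ 3 := by
    rw [hU, ← Real.rpow_natCast, ← Real.rpow_mul (by linarith)]
    norm_num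
  have hTU2 : T ^ (2 / 3 : ℝ) = U ^ 2 := by
    rw [hU, ← Real.rpow_natCast, ← Real.rpow_mul (by linarith)]
    norm_num
  set V := d ^ (3 / 4 : ℝ) * m ^ (3 / 4 : ℝ) with hV
  have hV1 : 1 ≤ V :=
    one_le_mul_of_one_le_of_one_le (Real.one_le_rpow hd (by norm_num))
      (Real.one_le_rpow hm (by norm_num))
  have hV2 : V ^ 2 = d * m * √(d * m) := by
    rw [hV, mul_pow, rpow_three_quarters_sq (by linarith), rpow_three_quarters_sq (by linarith),
      Real.sqrt_mul (by linarith)]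
    ring
  set B := U ^ 2 * V * K * √l with hB
  have hB0 : 0 ≤ B := by positivity
  have hB2 : B ^ 2 = U ^ 4 * (d * m * √(d * m)) * K ^ 2 * l := by
    rw [hB, mul_pow, mul_pow, mul_pow, hV2, Real.sq_sqrt (by linarith)]
    ring
  -- The 16 is 8 times the 2 from L ≤ 2U, and U⁴ is U · T. The product ab is 160 B², with 160 ≤ 14².
  obtain ⟨ε, hε, hbal⟩ := exists_balancing (a := 16 * K ^ 2 * d * m * U ^ 4)
    (b := 10 * √(d * m) * l) (by positivity) (by positivity)
  have hsqrt : √(16 * K ^ 2 * d * m * U ^ 4 * (10 * √(d * m) * l)) ≤ 14 * B := by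
    refine Real.sqrt_le_iff.2 ⟨by positivity, ?_⟩
    rw [mul_pow, hB2]
    have : 0 ≤ U ^ 4 * (d * m * √(d * m)) * K ^ 2 * l := by positivity
    linarith
  refine ⟨ε, ⌈U⌉₊, hε, Nat.one_le_ceil_iff.2 (by linarith), ?_⟩
  have hL1 : U ≤ (⌈U⌉₊ : ℝ) := Nat.le_ceil U
  have hL2 : (⌈U⌉₊ : ℝ) ≤ 2 * U := by
    linarith [Nat.ceil_lt_add_one (by linarith : 0 ≤ U)]
  set L := (⌈U⌉₊ : ℝ)
  have h1 : K / (Real.exp 1 * L) * T ≤ B := by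
    have hl' : 1 / 2 ≤ √l := Real.le_sqrt_of_sq_le (by linarith)
    have he : 2 ≤ Real.exp 1 := by linarith [Real.add_one_le_exp 1]
    rw [div_mul_eq_mul_div, div_le_iff₀ (by positivity), hTU]
    have h2 : 1 ≤ √l * Real.exp 1 := by nlinarith
    have h3 : 1 ≤ V * (√l * Real.exp 1) := one_le_mul_of_one_le_of_one_le hV1 h2
    calc K * U ^ 3 = K * U ^ 2 * U * 1 := by ring
      _ ≤ K * U ^ 2 * L * (V * (√l * Real.exp 1)) := by gcongr
      _ = _ := by rw [hB]; ring
  have h2 : 8 * ε * K ^ 2 * d * L * m * T ≤ ε * (16 * K ^ 2 * d * m * U ^ 4) := by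
    calc 8 * ε * K ^ 2 * d * L * m * T ≤ 8 * ε * K ^ 2 * d * (2 * U) * m * T := by gcongr
      _ = _ := by rw [hTU]; ring
  calc _ ≤ (ε * (16 * K ^ 2 * d * m * U ^ 4) + 10 * √(d * m) * l / ε)
        + K / (Real.exp 1 * L) * T := by
        have : 10 / ε * √(d * m) * l = 10 * √(d * m) * l / ε := by ring
        linarith
    _ ≤ 2 * (14 * B) + B := by rw [hbal]; linarith
    _ ≤ 30 * B := by linarith
    _ = _ := by rw [hB, hV, hTU2]; ring

lemma transductive_bound_le_of_le {d T K m l : ℝ} (hd : 0 ≤ d) (hm : 0 ≤ m) (hdT : d ≤ T) :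
    30 * d ^ (1 / 4 : ℝ) * m ^ (3 / 4 : ℝ) * √(K * T * l)
      ≤ 30 * m ^ (3 / 4 : ℝ) * T ^ (3 / 4 : ℝ) * √(K * l) := by
  have hT : 0 ≤ T := hd.trans hdT
  have h1 : √(K * T * l) = T ^ (1 / 2 : ℝ) * √(K * l) := by
    rw [show K * T * l = T * (K * l) by ring, Real.sqrt_mul hT, Real.sqrt_eq_rpow T]
  have h2 : T ^ (3 / 4 : ℝ) = T ^ (1 / 4 : ℝ) * T ^ (1 / 2 : ℝ) := by
    rw [← Real.rpow_add_of_nonneg hT (by norm_num) (by norm_num)]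
    norm_num
  rw [h1, h2]
  calc _ ≤ 30 * T ^ (1 / 4 : ℝ) * m ^ (3 / 4 : ℝ) * (T ^ (1 / 2 : ℝ) * √(K * l)) := by gcongr
    _ = _ := by ring

lemma half_le_log {N : ℕ} (hN : 2 ≤ N) : 1 / 2 ≤ Real.log N := by
  have h2 : (2 : ℝ) ≤ N := by exact_mod_cast hN
  have h3 := Real.log_le_log (by norm_num) h2
  have h4 := Real.log_two_gt_d9
  norm_num at h4
  linarith

/-- The case in which the tuned bounds do not vanish. -/
lemma degenerate_or_positive (K m d N T : ℕ) :
    (K = 0 ∨ m = 0 ∨ d = 0 ∨ N ≤ 1 ∨ T = 0) ∨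
      ((1 : ℝ) ≤ K ∧ (1 : ℝ) ≤ m ∧ (1 : ℝ) ≤ d ∧ 1 / 2 ≤ Real.log N ∧ (1 : ℝ) ≤ T) := by
  by_cases h : K = 0 ∨ m = 0 ∨ d = 0 ∨ N ≤ 1 ∨ T = 0
  · exact Or.inl h
  · push Not at h
    obtain ⟨hK, hm, hd, hN, hT⟩ := h
    simp only [Nat.one_le_cast]
    exact Or.inr ⟨Nat.one_le_iff_ne_zero.2 hK, Nat.one_le_iff_ne_zero.2 hm,
      Nat.one_le_iff_ne_zero.2 hd, half_le_log hN, Nat.one_le_iff_ne_zero.2 hT⟩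

namespace Run

variable {K m d N T L : ℕ} {ε : ℝ} (R : Run.{u, v} K m d N T L ε)

lemma regret_nonpos_of_degenerate (hd : d = 0 → R.regret ≤ 0)
    (h : K = 0 ∨ m = 0 ∨ d = 0 ∨ N ≤ 1 ∨ T = 0) : R.regret ≤ 0 := by
  rcases h with h | h | h | h | h
  · exact R.regret_nonpos_of_coordinates_eq_zero h
  · exact R.regret_nonpos_of_actions_eq_zero h
  · exact hd h
  · exact R.regret_nonpos_of_card_le_one h
  · exact R.regret_nonpos_of_rounds_eq_zero h

end Run

lemma exists_parameters_regret_transductive (K m d N T : ℕ) :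
    ∃ (ε : ℝ) (L : ℕ), 0 < ε ∧ 1 ≤ L ∧
      ∀ R : Run.{u, v} K m d N T L ε, R.LossLeOne → R.Transductive →
        R.regret ≤ 30 * (d : ℝ) ^ (1 / 4 : ℝ) * (m : ℝ) ^ (3 / 4 : ℝ)
          * √((K : ℝ) * T * Real.log N) := by
  rcases degenerate_or_positive K m d N T with h | ⟨hK, hm, hd, hN, hT⟩
  · refine ⟨1, 1, one_pos, le_rfl, fun R _ hR => ?_⟩
    exact (R.regret_nonpos_of_degenerate (fun hd => R.regret_nonpos_of_transductive hd hR) h).trans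
      (by positivity)
  · obtain ⟨ε, L, hε, hL, hb⟩ := exists_parameters_transductive hK hm hd hT hN
    refine ⟨ε, L, hε, hL, fun R hR1 hR => (R.regret_le_of_transductive hε hL hR).trans ?_⟩
    refine le_trans ?_ hb
    have h1 := R.sumLoss_le hR1
    have h2 := R.sumSqLoss_le hR1
    gcongr

lemma exists_parameters_regret_separator (K m d N T : ℕ) :
    ∃ (ε : ℝ) (L : ℕ), 0 < ε ∧ 1 ≤ L ∧
      ∀ R : Run.{u, v} K m d N T L ε, R.LossLeOne → R.SmallSeparator →
        R.regret ≤ 30 * (T : ℝ) ^ (2 / 3 : ℝ) * (d : ℝ) ^ (3 / 4 : ℝ) * (m : ℝ) ^ (3 / 4 : ℝ)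
          * K * √(Real.log N) := by
  rcases degenerate_or_positive K m d N T with h | ⟨hK, hm, hd, hN, hT⟩
  · refine ⟨1, 1, one_pos, le_rfl, fun R _ hR => ?_⟩
    exact (R.regret_nonpos_of_degenerate (fun hd => R.regret_nonpos_of_smallSeparator hd hR)
      h).trans (by positivity)
  · obtain ⟨ε, L, hε, hL, hb⟩ := exists_parameters_separator hK hm hd hT hN
    refine ⟨ε, L, hε, hL, fun R hR1 hR => (R.regret_le_of_smallSeparator hε hL hR).trans ?_⟩
    refine le_trans ?_ hb
    have h1 := R.sumLoss_le hR1
    have h2 := R.sumSqLoss_le hR1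
    gcongr

end SemiBandit

theorem mainTheorem1 :
    -- the regret for arbitrary parameters `ε` and `L`
    (∀ (K m d N T L : ℕ) (ε : ℝ), 0 < ε → 1 ≤ L →
      ∀ R : SemiBandit.Run.{u, v} K m d N T L ε,
        (R.Transductive →
          R.regret ≤ 2 * ε * m * K * R.sumSqLoss
            + 10 / ε * √((d : ℝ) * m) * Real.log N
            + K / (Real.exp 1 * L) * R.sumLoss) ∧
        (R.SmallSeparator →
          R.regret ≤ 8 * ε * (K : ℝ) ^ 2 * d * L * m * R.sumSqLoss
            + 10 / ε * √((d : ℝ) * m) * Real.log N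
            + K / (Real.exp 1 * L) * R.sumLoss)) ∧
    -- the regret for parameters tuned to `K`, `m`, `d`, `N`, `T`
    (∃ c : ℝ, 0 < c ∧ ∀ K m d N T : ℕ,
      (∃ (ε : ℝ) (L : ℕ), 0 < ε ∧ 1 ≤ L ∧
        ∀ R : SemiBandit.Run.{u, v} K m d N T L ε, R.LossLeOne → R.Transductive →
          R.regret ≤ c * (d : ℝ) ^ (1 / 4 : ℝ) * (m : ℝ) ^ (3 / 4 : ℝ)
            * √((K : ℝ) * T * Real.log N) ∧
          (d ≤ T → R.regret ≤ c * (m : ℝ) ^ (3 / 4 : ℝ) * (T : ℝ) ^ (3 / 4 : ℝ)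
            * √((K : ℝ) * Real.log N))) ∧
      (∃ (ε : ℝ) (L : ℕ), 0 < ε ∧ 1 ≤ L ∧
        ∀ R : SemiBandit.Run.{u, v} K m d N T L ε, R.LossLeOne → R.SmallSeparator →
          R.regret ≤ c * (T : ℝ) ^ (2 / 3 : ℝ) * (d : ℝ) ^ (3 / 4 : ℝ) * (m : ℝ) ^ (3 / 4 : ℝ)
            * K * √(Real.log N))) := by
  -- The constant 30 serves both tuned bounds.
  refine ⟨fun K m d N T L ε hε hL R => ⟨R.regret_le_of_transductive hε hL,
    R.regret_le_of_smallSeparator hε hL⟩, 30, by norm_num, fun K m d N T => ⟨?_, ?_⟩⟩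
  · obtain ⟨ε, L, hε, hL, h⟩ := SemiBandit.exists_parameters_regret_transductive K m d N T
    refine ⟨ε, L, hε, hL, fun R h1 hR => ⟨h R h1 hR, fun hdT => (h R h1 hR).trans ?_⟩⟩
    exact SemiBandit.transductive_bound_le_of_le (Nat.cast_nonneg d) (Nat.cast_nonneg m)
      (Nat.cast_le.2 hdT)
  · exact SemiBandit.exists_parameters_regret_separator K m d N T
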